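/- Setting. Let $\Theta\subset\mathbb{R}^{n}$ with $\|\theta\|\le 1$ for all $\theta\in\Theta$, let $Z$ be a separable metric space, let $\mathcal D(\theta)$, $\theta\in\Theta$, be Borel probability measures on $Z$, and let $\ell(z;\theta)\in[0,1]$ be a loss. Put $\mathrm{DPR}(\theta,\theta')=\mathbb{E}_{z\sim\mathcal D(\theta)}\ell(z;\theta')$ and $\mathrm{PR}(\theta)=\mathrm{DPR}(\theta,\theta)$; assume that $\mathrm{PR}$ attains its minimum and put $\Delta(\theta)=\mathrm{PR}(\theta)-\min\mathrm{PR}$. Assume that $\ell(z;\theta)$ is $L_z$-Lipschitz in $z$ for every $\theta$, and that $\mathcal W_1(\mathcal D(\theta),\mathcal D(\theta'))\le\epsilon\|\theta-\theta'\|$ for all $\theta,\theta'$ ($L_z,\epsilon\ge 0$). Write $\alpha=L_z\epsilon$ and $$\mathfrak C^*(\ell)=\sup_{\theta}\sup_{k\in\mathbb N}\sqrt{k}\;\mathbb{E}\sup_{\theta'}\Big|\frac1k\sum_{j=1}^k\sigma_j\ell(z_j;\theta')\Big|,$$ with independent uniform signs $\sigma_j$ and $z_j\sim\mathcal D(\theta)$.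 An $r$-cover of $A\subseteq\Theta$ is a finite set of points of $A$ such that every point of $A$ has distance at most $r$ to one of them; it is minimal if its cardinality is smallest. Put $\mathrm{Ball}_r(\theta)=\{\theta'\in\Theta:\|\theta'-\theta\|\le r\}$. For $F:\Theta\times\Theta\to\mathbb R$ and a finite set $P\subseteq\Theta$ let $$\mathrm{LB}_{F,P}(\theta)=\max_{\theta'\in P}\big(F(\theta',\theta)-\alpha\|\theta-\theta'\|\big),\qquad \mathrm{Min}_{F,P}=\inf_{\theta\in\Theta}\min_{\theta'\in P}\big(F(\theta',\theta)+\alpha\|\theta-\theta'\|\big),$$ which are $-\infty$ and $+\infty$ for $P=\emptyset$. Sequential zooming dimension. The instance has $\alpha$-sequential zooming dimension $d\ge 0$ with constant $c$ if for all $0<r\le s\le 1$ and every minimal $s$-cover $S$ of any subset of $\{\theta:\Delta(\theta)\le16\alpha s\}$, the expected number, over a uniformly random ordering of $S$, of points $\theta\in S$ with $16\alpha r\le\Delta(\theta)<32\alpha r$ and $\inf_{\theta''\in\mathrm{Ball}_s(\theta)}\mathrm{LB}_{\mathrm{DPR},P}(\theta'')\le\mathrm{Min}_{\mathrm{DPR},P}+4\alpha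 s$, where $P$ is the set of points of $S$ that precede $\theta$, is at most $c\,(3/s)^d$. Algorithm (performative confidence bounds; inputs $T$, $m_0$, $\epsilon$, $L_z$, $\mathfrak C$). Start with the active set $A=\Theta$. For phases $p=0,1,\dots$: let $\gamma_p=2^{-p}$, $r_p=\gamma_p/(L_z\epsilon)$ (which is $\infty$ if $L_z\epsilon=0$), $n_p=\big\lceil(2\mathfrak C+3\sqrt{\log T})^2/(\gamma_p^2m_0)\big\rceil$; let $S$ be a minimal $r_p$-cover of $A$ and $P=\emptyset$. While $S\ne\emptyset$: draw $\theta$ uniformly from $S$; deploy $\theta$ for $n_p$ time steps, observing $m_0$ independent samples from $\mathcal D(\theta)$ in each step, and let $\widehat{\mathrm{DPR}}(\theta,\theta')$ be the average of $\ell(\cdot\,;\theta')$ over these $n_pm_0$ samples; move $\theta$ from $S$ to $P$; remove from $A$ all $x$ with $\mathrm{LB}_{\widehat{\mathrm{DPR}},P}(x)>\mathrm{Min}_{\widehat{\mathrm{DPR}},P}+2\gamma_p$; remove from $S$ all points $\theta'$ with $\mathrm{Ball}_{r_p}(\theta')\cap A=\emptyset$. The run stops after $T$ time steps. The choice among minimal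 covers is arbitrary; if $A$ becomes empty, an arbitrary fixed model is deployed until time $T$. Let $\mathrm{Reg}(T)=\sum_{t=1}^T\big(\mathbb{E}\,\mathrm{PR}(\theta_t)-\min\mathrm{PR}\big)$, where $\theta_t$ is the model deployed at time $t$. Theorem (main regret bound). For all $n$, $d\ge0$ and $c$ there is a constant $K=K(n,d,c)$ such that the following holds for every instance as above with $\Theta\subset\mathbb R^n$ that has $(L_z\epsilon)$-sequential zooming dimension $d$ with constant $c$. Let $T$ be a horizon, $m_0\ge1$, $\mathfrak C\geq 0$ with $\mathfrak C^*(\ell)\le\mathfrak C$, $\mathcal B=\sqrt{\log T}+\mathfrak C$, and $m_0\le\mathcal B^2$. Then the algorithm satisfies $$\mathrm{Reg}(T)\le K\left(T^{\frac{d+1}{d+2}}\left(\frac{(L_z\epsilon)^d\mathcal B^2}{m_0}\right)^{\frac1{d+2}}+\sqrt T\,\frac{\mathcal B}{\sqrt{m_0}}\right).$$ In particular the bound depends on the Lipschitz constants through $L_z\epsilon$ only; no regularity of $\ell(z;\theta)$ or of $\mathrm{PR}(\theta)$ in $\theta$ is assumed. -/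

import Mathlib

open MeasureTheory
open scoped ENNReal NNReal

noncomputable section

namespace PerfPred

/-! ### Performative prediction: risks, sensitivity, complexity

`M` is the space of models, `Z` the space of data points, `D θ` the data distribution induced by
the deployment of `θ`, and `loss z θ` the loss of the model `θ` on the data point `z`. -/

/-- Decoupled performative risk `DPR(θ, θ') = E_{z ∼ D(θ)} ℓ(z; θ')`. -/
def DPR {M Z : Type*} [MeasurableSpace Z] (D : M → Measure Z) (loss : Z → M → ℝ)
    (θ θ' : M) : ℝ :=
  ∫ z, loss z θ' ∂(D θ)

/-- Performative risk `PR(θ) = E_{z ∼ D(θ)} ℓ(z; θ)`. -/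
def PR {M Z : Type*} [MeasurableSpace Z] (D : M → Measure Z) (loss : Z → M → ℝ) (θ : M) : ℝ :=
  DPR D loss θ θ

/-- Suboptimality `Δ(θ) = PR(θ) - min PR`. -/
def gap {M Z : Type*} [MeasurableSpace Z] (D : M → Measure Z) (loss : Z → M → ℝ) (θ : M) : ℝ :=
  PR D loss θ - ⨅ θ', PR D loss θ'

/-- Wasserstein-1 distance: infimum of the transport cost over all couplings. -/
def wasserstein1 {Z : Type*} [PseudoEMetricSpace Z] [MeasurableSpace Z] (μ ν : Measure Z) : ℝ≥0∞ :=
  ⨅ (π : Measure (Z × Z)) (_ : π.fst = μ) (_ : π.snd = ν), ∫⁻ p, edist p.1 p.2 ∂π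

/-- `ε`-sensitivity of a distribution map. -/
def IsSensitive {M Z : Type*} [PseudoEMetricSpace M] [PseudoEMetricSpace Z] [MeasurableSpace Z]
    (D : M → Measure Z) (ε : ℝ≥0) : Prop :=
  ∀ θ θ', wasserstein1 (D θ) (D θ') ≤ ε * edist θ θ'

/-- The complexity
`sup_θ sup_n √n · E sup_θ' |n⁻¹ ∑_j σ_j ℓ(z_j; θ')|`, for independent uniform signs `σ_j` and
`z_j ∼ D(θ)`. -/
def rademacherComplexity {M Z : Type*} [MeasurableSpace Z] (D : M → Measure Z)
    (loss : Z → M → ℝ) : ℝ≥0∞ :=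
  ⨆ (θ : M) (n : ℕ), ENNReal.ofReal (Real.sqrt n) *
    (((2 : ℝ≥0∞) ^ n)⁻¹ * ∑ σ : Fin n → ℤˣ,
      ∫⁻ z : Fin n → Z, ⨆ θ' : M,
        ENNReal.ofReal |(n : ℝ)⁻¹ * ∑ j, (((σ j : ℤˣ) : ℤ) : ℝ) * loss (z j) θ'|
        ∂(Measure.pi fun _ => D θ))

/-! ### Covers and confidence bounds -/

/-- The closed ball `{θ' : ‖θ' - θ‖ ≤ r}` in the space of models; the radius may be infinite. -/
def ball {M : Type*} [PseudoEMetricSpace M] (r : ℝ≥0∞) (θ : M) : Set M := {θ' | edist θ' θ ≤ r}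

/-- `S` is a finite `r`-cover (`r`-net) of `A` by points of `A`. -/
def IsCoverOf {M : Type*} [PseudoEMetricSpace M] (r : ℝ≥0∞) (A : Set M) (S : Finset M) : Prop :=
  (S : Set M) ⊆ A ∧ ∀ θ ∈ A, ∃ c ∈ S, θ ∈ ball r c

/-- `S` is a minimal `r`-cover of `A`: one with the smallest number of points. -/
def IsMinimalCover {M : Type*} [PseudoEMetricSpace M] (r : ℝ≥0∞) (A : Set M) (S : Finset M) :
    Prop :=
  IsCoverOf r A S ∧ ∀ S' : Finset M, IsCoverOf r A S' → S.card ≤ S'.card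

/-- `max_{θ' ∈ P} (F(θ', θ) - α ‖θ - θ'‖)`: the lower confidence bound at `θ`
obtained from the (exact or estimated) values `F(θ', ·)` of the models `θ'` in `P`. -/
def lowerBound {M : Type*} [PseudoMetricSpace M] (F : M → M → ℝ) (α : ℝ) (P : Finset M) (θ : M) :
    EReal :=
  ⨆ θ' ∈ P, ((F θ' θ - α * dist θ θ' : ℝ) : EReal)

/-- `min_θ min_{θ' ∈ P} (F(θ', θ) + α ‖θ' - θ‖)`: the upper confidence bound on the minimal
performative risk. -/
def upperMin {M : Type*} [PseudoMetricSpace M] (F : M → M → ℝ) (α : ℝ) (P : Finset M) : EReal :=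
  ⨅ (θ : M), ⨅ θ' ∈ P, ((F θ' θ + α * dist θ' θ : ℝ) : EReal)

/-! ### Sequential zooming dimension -/

open Classical in
/-- The points of `S` that come strictly before `θ` in the enumeration `π`. -/
def earlier {M : Type*} (S : Finset M) (π : S ≃ Fin S.card) (θ : S) : Finset M :=
  (Finset.univ.filter fun θ' : S => π θ' < π θ).map (Function.Embedding.subtype _)

/-- `PR^s_LB(π(θ)) ≤ PR_min(π(θ)) + 4αs`: exact knowledge of `DPR(θ', ·)` for all `θ'` that come
before `θ` does not discard `θ`. For the first point, `PR^s_LB = -∞` and `PR_min = ∞`. -/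
def Survives {M Z : Type*} [PseudoMetricSpace M] [MeasurableSpace Z] (D : M → Measure Z)
    (loss : Z → M → ℝ) (α s : ℝ) (S : Finset M) (π : S ≃ Fin S.card) (θ : S) : Prop :=
  (⨅ θ'' ∈ ball (ENNReal.ofReal s) (θ : M), lowerBound (DPR D loss) α (earlier S π θ) θ'') ≤
    upperMin (DPR D loss) α (earlier S π θ) + ((4 * α * s : ℝ) : EReal)

open Classical in
/-- The expected number, over a uniformly random enumeration `π` of `S`, of the points `θ ∈ S` with
`16αr ≤ Δ(θ) < 32αr` that are not discarded. -/
def expectedSurvivors {M Z : Type*} [PseudoMetricSpace M] [MeasurableSpace Z] (D : M → Measure Z)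
    (loss : Z → M → ℝ) (α r s : ℝ) (S : Finset M) : ℝ :=
  (Fintype.card (S ≃ Fin S.card) : ℝ)⁻¹ * ∑ π : S ≃ Fin S.card,
    ((Finset.univ.filter fun θ : S =>
      16 * α * r ≤ gap D loss θ ∧ gap D loss θ < 32 * α * r ∧ Survives D loss α s S π θ).card : ℝ)

/-- The instance has `α`-sequential zooming dimension `d`, with `c` as the constant multiple. -/
def HasSeqZoomingDim {M Z : Type*} [PseudoMetricSpace M] [MeasurableSpace Z] (D : M → Measure Z)
    (loss : Z → M → ℝ) (α d c : ℝ) : Prop :=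
  ∀ r s : ℝ, 0 < r → r ≤ s → s ≤ 1 →
    ∀ A : Set M, (∀ θ ∈ A, gap D loss θ ≤ 16 * α * s) →
      ∀ S : Finset M, IsMinimalCover (ENNReal.ofReal s) A S →
        expectedSurvivors D loss α r s S ≤ c * (3 / s) ^ d

/-! ### The performative confidence bounds algorithm -/

/-- The inputs of the algorithm: horizon `T`, number `m₀` of samples per step, sensitivity `ε`,
Lipschitz constant `Lz`, complexity bound `C`. -/
structure Input where
  T : ℕ
  m₀ : ℕ
  ε : ℝ≥0
  Lz : ℝ≥0
  C : ℝ

/-- Error tolerance `γ_p = 2^{-p}`. -/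
def tol (p : ℕ) : ℝ := (1 / 2) ^ p

/-- Net radius `r_p = γ_p / (Lz ε)`, which is `∞` if `Lz ε = 0`. -/
def Input.radius (I : Input) (p : ℕ) : ℝ≥0∞ := ENNReal.ofReal (tol p) / ((I.Lz * I.ε : ℝ≥0) : ℝ≥0∞)

/-- Number of steps of a deployment in phase `p`:
`n_p = ⌈(2C + 3√(log T))² / (γ_p² m₀)⌉`. -/
def Input.steps (I : Input) (p : ℕ) : ℕ :=
  ⌈(2 * I.C + 3 * Real.sqrt (Real.log I.T)) ^ 2 / (tol p ^ 2 * I.m₀)⌉₊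

/-- The state of the algorithm between two deployments: the phase `p`, the active set `A`, the
remaining net points `S_p`, the models `P_p` deployed so far in the phase, and the
estimates `est θ' = DPR-hat(θ', ·)` for `θ' ∈ P_p`. -/
structure State (M : Type*) where
  phase : ℕ
  active : Set M
  net : Finset M
  deployed : Finset M
  est : M → M → ℝ

/-- Beginning of phase `p` with active set `A`; `N p A` is the minimal cover of `A` that is used. -/
def State.start {M : Type*} (N : ℕ → Set M → Finset M) (p : ℕ) (A : Set M) : State M where
  phase := p
  active := A
  net := N p A
  deployed := ∅
  est := fun _ _ => 0

open Classical in
/-- The part of the loop body after the deployment of the net point `θ`, from whose distribution the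
samples `z` were collected, but before the test whether the phase has ended. -/
def State.update {M Z : Type*} [PseudoMetricSpace M] (loss : Z → M → ℝ) (I : Input)
    (σ : State M) (θ : M) (z : Fin (I.steps σ.phase * I.m₀) → Z) : State M :=
  let est : M → M → ℝ := Function.update σ.est θ fun θ' =>
    ((I.steps σ.phase * I.m₀ : ℕ) : ℝ)⁻¹ * ∑ j, loss (z j) θ'
  let P : Finset M := insert θ σ.deployed
  let α : ℝ := I.Lz * I.ε
  let A : Set M := σ.active \ {x ∈ σ.active |
    upperMin est α P + ((2 * tol σ.phase : ℝ) : EReal) < lowerBound est α P x}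
  { phase := σ.phase
    active := A
    net := (σ.net.erase θ).filter fun c => (ball (I.radius σ.phase) c ∩ A).Nonempty
    deployed := P
    est := est }

open Classical in
/-- The state after the deployment of `θ` with samples `z`; when no net point is left, the
next phase begins. -/
def State.next {M Z : Type*} [PseudoMetricSpace M] (loss : Z → M → ℝ) (I : Input)
    (N : ℕ → Set M → Finset M) (σ : State M) (θ : M) (z : Fin (I.steps σ.phase * I.m₀) → Z) :
    State M :=
  let σ' := σ.update loss I θ z
  if σ'.net = ∅ then State.start N (σ'.phase + 1) σ'.active else σ'

/-- Upper expectation: the infimum of `∫ g` over the measurable `g ≥ f`. For measurable `f` this is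
the expectation of `f`, see `upperExpectation_eq`. -/
def upperExpectation {X : Type*} [MeasurableSpace X] (μ : Measure X) (f : X → ℝ≥0∞) : ℝ≥0∞ :=
  ⨅ (g : X → ℝ≥0∞) (_ : Measurable g) (_ : ∀ x, f x ≤ g x), ∫⁻ x, g x ∂μ

theorem upperExpectation_eq {X : Type*} [MeasurableSpace X] (μ : Measure X) (f : X → ℝ≥0∞)
    (hf : Measurable f) : upperExpectation μ f = ∫⁻ x, f x ∂μ :=
  le_antisymm (iInf_le_of_le f (iInf_le_of_le hf (iInf_le _ fun _ => le_rfl)))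
    (le_iInf fun _ => le_iInf fun _ => le_iInf fun h => lintegral_mono h)

open Classical in
/-- Expected regret `E ∑ Δ(θ_t)` over the next `k` deployments, started from the state `σ` with `t`
time steps left until the horizon (a deployment that exceeds the horizon is cut off there).
The net point is drawn uniformly from the remaining net, then `n_p m₀` samples
are drawn independently from its distribution. The net is empty only if all models have been
eliminated; in that case the model `θ₀` is deployed until the horizon. -/
def expRegretFrom {M Z : Type*} [PseudoMetricSpace M] [MeasurableSpace Z] (D : M → Measure Z)
    (loss : Z → M → ℝ) (I : Input) (N : ℕ → Set M → Finset M) (θ₀ : M) :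
    ℕ → ℕ → State M → ℝ≥0∞
  | 0, _, _ => 0
  | k + 1, t, σ =>
    if σ.net = ∅ then ENNReal.ofReal (t * gap D loss θ₀)
    else (σ.net.card : ℝ≥0∞)⁻¹ * ∑ θ ∈ σ.net,
      (ENNReal.ofReal ((min (I.steps σ.phase) t : ℕ) * gap D loss θ) +
        upperExpectation (Measure.pi fun _ : Fin (I.steps σ.phase * I.m₀) => D θ) fun z =>
          expRegretFrom D loss I N θ₀ k (t - I.steps σ.phase) (σ.next loss I N θ z))

/-- The performative regret `Reg(T) = ∑_{t ≤ T} (E PR(θ_t) - min PR)` of the algorithm: it starts in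
phase `0` with all models active, and the number of deployments within the horizon `T` is not
limited. -/
def regret {M Z : Type*} [PseudoMetricSpace M] [MeasurableSpace Z] (D : M → Measure Z)
    (loss : Z → M → ℝ) (I : Input) (N : ℕ → Set M → Finset M) (θ₀ : M) : ℝ≥0∞ :=
  ⨆ k : ℕ, expRegretFrom D loss I N θ₀ k I.T (State.start N 0 Set.univ)

end PerfPred

end

noncomputable section

namespace PerfPred

/-- McDiarmid's bound on the moment generating function of a function with bounded differences. -/
theorem integral_exp_le_of_boundedDiff {Z : Type*} [MeasurableSpace Z] (μ : Measure Z)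
    [IsProbabilityMeasure μ] {b : ℝ} (hb : 0 ≤ b) (t : ℝ) :
    ∀ (n : ℕ) (f : (Fin n → Z) → ℝ), Measurable f → (∀ z, f z ∈ Set.Icc (0 : ℝ) 1) →
      (∀ z i x, f (Function.update z i x) ≤ f z + b) →
      ∫ z, Real.exp (t * (f z - ∫ w, f w ∂(Measure.pi fun _ => μ))) ∂(Measure.pi fun _ => μ) ≤
        Real.exp (n * ((b / 2) ^ 2 * t ^ 2 / 2)) := by
  intro n
  induction n with
  | zero =>
    intro f _ _ _
    have h : ∀ z, f z = f default := fun z => by rw [Subsingleton.elim z default]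
    simp [h]
  | succ n ih =>
    intro f hf h01 hdiff
    let e := MeasurableEquiv.piFinSuccAbove (fun _ : Fin (n + 1) => Z) 0
    have he : MeasurePreserving e.symm (μ.prod (Measure.pi fun _ : Fin n => μ))
        (Measure.pi fun _ => μ) := (measurePreserving_piFinSuccAbove (fun _ => μ) 0).symm
    have hes : ∀ p : Z × (Fin n → Z), e.symm p = Fin.cons p.1 p.2 := fun p => by
      simp [e, MeasurableEquiv.piFinSuccAbove_symm_apply, Fin.insertNthEquiv]
    let F : Z → (Fin n → Z) → ℝ := fun x y => f (Fin.cons x y)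
    have hFe : Function.uncurry F = f ∘ e.symm := by
      ext p; simp only [Function.comp, hes]; rfl
    have hFm : Measurable (Function.uncurry F) := hFe ▸ hf.comp e.symm.measurable
    have hFx : ∀ x, Measurable (F x) := fun x => hFm.comp measurable_prodMk_left
    have hF01 : ∀ x y, F x y ∈ Set.Icc (0 : ℝ) 1 := fun x y => h01 _
    have hFi : Integrable (Function.uncurry F) (μ.prod (Measure.pi fun _ : Fin n => μ)) :=
      Integrable.of_mem_Icc 0 1 hFm.aemeasurable (Filter.Eventually.of_forall fun p => h01 _)
    have hFxi : ∀ x, Integrable (F x) (Measure.pi fun _ : Fin n => μ) := fun x =>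
      Integrable.of_mem_Icc 0 1 (hFx x).aemeasurable (Filter.Eventually.of_forall fun p => h01 _)
    let g : Z → ℝ := fun x => ∫ y, F x y ∂(Measure.pi fun _ : Fin n => μ)
    have hgm : Measurable g := (hFm.stronglyMeasurable.integral_prod_right).measurable
    have hg0 : ∀ x, 0 ≤ g x := fun x => integral_nonneg fun y => (h01 _).1
    have hgdiff : ∀ x x', g x' ≤ g x + b := by
      intro x x'
      have : g x + b = ∫ y, (F x y + b) ∂(Measure.pi fun _ : Fin n => μ) := by
        rw [integral_add (hFxi x) (integrable_const _)]; simp [g]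
      rw [this]
      refine integral_mono (hFxi x') ((hFxi x).add (integrable_const _)) fun y => ?_
      have h := hdiff (Fin.cons x y) 0 x'
      rw [Fin.update_cons_zero] at h
      exact h
    have hm : ∫ w, f w ∂(Measure.pi fun _ => μ) = ∫ x, g x ∂μ := by
      rw [← he.integral_comp']
      simp only [hes]
      exact integral_prod _ hFi
    set m := ∫ w, f w ∂(Measure.pi fun _ => μ) with hmdef
    have hHoeff : ∫ x, Real.exp (t * (g x - m)) ∂μ ≤ Real.exp ((b / 2) ^ 2 * t ^ 2 / 2) := by
      obtain ⟨x₀⟩ : Nonempty Z := (inferInstance : NeZero μ).out |> fun h => by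
        by_contra hne
        rw [not_nonempty_iff] at hne
        exact h (Measure.eq_zero_of_isEmpty μ)
      have hbdd : BddBelow (Set.range g) := ⟨0, by rintro _ ⟨x, rfl⟩; exact hg0 x⟩
      have hIcc : ∀ x, g x ∈ Set.Icc (sInf (Set.range g)) (sInf (Set.range g) + b) := fun x =>
        ⟨csInf_le hbdd ⟨x, rfl⟩, by
          have : g x - b ≤ sInf (Set.range g) := le_csInf ⟨_, x₀, rfl⟩ (by
            rintro _ ⟨x', rfl⟩; linarith [hgdiff x' x])
          linarith⟩
      have h := (ProbabilityTheory.hasSubgaussianMGF_of_mem_Icc hgm.aemeasurable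
        (Filter.Eventually.of_forall (p := fun x => g x ∈ _) hIcc) : _).mgf_le t (μ := μ)
      rw [hm]
      simpa [ProbabilityTheory.mgf, abs_of_nonneg hb] using h
    have hexp_b : ∀ s r : ℝ, s ∈ Set.Icc (0 : ℝ) 1 → r ∈ Set.Icc (0 : ℝ) 1 →
        Real.exp (t * (s - r)) ∈ Set.Icc 0 (Real.exp |t|) := fun s r hs hr =>
      ⟨(Real.exp_pos _).le, Real.exp_le_exp.2 <| (le_abs_self _).trans <| by
        rw [abs_mul]
        exact mul_le_of_le_one_right (abs_nonneg _)
          (abs_le.2 ⟨by linarith [hs.1, hr.2], by linarith [hs.2, hr.1]⟩)⟩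
    have hg1 : ∀ x, g x ≤ 1 := fun x => by
      simpa using integral_mono (hFxi x) (integrable_const (1 : ℝ)) fun y => (hF01 x y).2
    have hgi : Integrable g μ := Integrable.of_mem_Icc 0 1 hgm.aemeasurable
      (Filter.Eventually.of_forall fun x => ⟨hg0 x, hg1 x⟩)
    have hm01 : m ∈ Set.Icc (0 : ℝ) 1 := by
      rw [hm]
      exact ⟨integral_nonneg hg0, by simpa using integral_mono hgi (integrable_const (1 : ℝ)) hg1⟩
    have hexp_i : Integrable (fun p : Z × (Fin n → Z) =>
        Real.exp (t * (F p.1 p.2 - m))) (μ.prod (Measure.pi fun _ : Fin n => μ)) :=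
      Integrable.of_mem_Icc 0 (Real.exp |t|)
        (((hFm.sub_const m).const_mul t).exp).aemeasurable
        (Filter.Eventually.of_forall fun p => hexp_b _ _ (hF01 _ _) hm01)
    calc ∫ z, Real.exp (t * (f z - m)) ∂(Measure.pi fun _ => μ)
        = ∫ p, Real.exp (t * (F p.1 p.2 - m)) ∂(μ.prod (Measure.pi fun _ : Fin n => μ)) := by
          rw [← he.integral_comp']
          simp only [hes, F]
      _ = ∫ x, ∫ y, Real.exp (t * (F x y - m)) ∂(Measure.pi fun _ : Fin n => μ) ∂μ :=
          integral_prod _ hexp_i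
      _ ≤ ∫ x, Real.exp (n * ((b / 2) ^ 2 * t ^ 2 / 2)) * Real.exp (t * (g x - m)) ∂μ := by
          refine integral_mono hexp_i.integral_prod_left
            (((Integrable.of_mem_Icc 0 (Real.exp |t|)
              (((hgm.sub_const m).const_mul t).exp).aemeasurable
              (Filter.Eventually.of_forall fun x => hexp_b _ _ ⟨hg0 x, hg1 x⟩ hm01))).const_mul _)
            fun x => ?_
          have h1 : ∀ y, Real.exp (t * (F x y - m)) =
              Real.exp (t * (F x y - g x)) * Real.exp (t * (g x - m)) := fun y => by
            rw [← Real.exp_add]; ring_nf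
          simp only [h1]
          rw [integral_mul_const]
          refine mul_le_mul_of_nonneg_right (ih (F x) (hFx x) (hF01 x) fun z i x' => ?_)
            (Real.exp_pos _).le
          have h := hdiff (Fin.cons x z) i.succ x'
          rwa [← Fin.cons_update] at h
      _ ≤ Real.exp (n * ((b / 2) ^ 2 * t ^ 2 / 2)) * Real.exp ((b / 2) ^ 2 * t ^ 2 / 2) := by
          rw [integral_const_mul]
          exact mul_le_mul_of_nonneg_left hHoeff (Real.exp_pos _).le
      _ = Real.exp ((n + 1 : ℕ) * ((b / 2) ^ 2 * t ^ 2 / 2)) := by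
          rw [← Real.exp_add]; push_cast; ring_nf

/-- **McDiarmid's inequality** for a function of `n` independent variables with values in `[0, 1]`
and differences bounded by `1 / n`. -/
theorem measure_ge_le_of_boundedDiff {Z : Type*} [MeasurableSpace Z] (μ : Measure Z)
    [IsProbabilityMeasure μ] {n : ℕ} (hn : 0 < n) {f : (Fin n → Z) → ℝ} (hf : Measurable f)
    (h01 : ∀ z, f z ∈ Set.Icc (0 : ℝ) 1)
    (hdiff : ∀ z i x, f (Function.update z i x) ≤ f z + (n : ℝ)⁻¹) {u : ℝ} (hu : 0 ≤ u) :
    (Measure.pi fun _ => μ).real {z | ∫ w, f w ∂(Measure.pi fun _ => μ) + u ≤ f z} ≤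
      Real.exp (-(2 * n * u ^ 2)) := by
  set m := ∫ w, f w ∂(Measure.pi fun _ => μ)
  have hn' : (0 : ℝ) < n := by exact_mod_cast hn
  have hmgf := integral_exp_le_of_boundedDiff μ (inv_nonneg.2 hn'.le) (4 * n * u) n f hf h01 hdiff
  have hint : Integrable (fun z => Real.exp (4 * n * u * (f z - m))) (Measure.pi fun _ => μ) :=
    ProbabilityTheory.integrable_exp_mul_of_mem_Icc (a := 0 - m) (b := 1 - m)
      (hf.sub_const m).aemeasurable
      (Filter.Eventually.of_forall fun z => ⟨by linarith [(h01 z).1], by linarith [(h01 z).2]⟩)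
  have h := ProbabilityTheory.measure_ge_le_exp_mul_mgf (μ := Measure.pi fun _ => μ)
    (X := fun z => f z - m) u (by positivity) hint
  have hset : {z | m + u ≤ f z} = {z | u ≤ f z - m} := by
    ext z; simp only [Set.mem_ofPred_eq]; constructor <;> intro h <;> linarith
  rw [hset]
  refine h.trans ((mul_le_mul_of_nonneg_left hmgf (Real.exp_pos _).le).trans ?_)
  rw [← Real.exp_add, Real.exp_le_exp]
  apply le_of_eq
  field_simp
  ring

/-- The largest deviation of an empirical average of the losses from its expectation. -/
def empiricalDeviation {M Z : Type*} [MeasurableSpace Z] (μ : Measure Z) (loss : Z → M → ℝ)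
    {n : ℕ} (z : Fin n → Z) : ℝ≥0∞ :=
  ⨆ θ, ENNReal.ofReal |(n : ℝ)⁻¹ * ∑ j, loss (z j) θ - ∫ x, loss x θ ∂μ|

theorem empiricalDeviation_update_le {M Z : Type*} [MeasurableSpace Z] {loss : Z → M → ℝ}
    (h01 : ∀ z θ, loss z θ ∈ Set.Icc (0 : ℝ) 1) (μ : Measure Z)
    {n : ℕ} (z : Fin n → Z) (i : Fin n) (x : Z) :
    empiricalDeviation μ loss (Function.update z i x) ≤
      empiricalDeviation μ loss z + ENNReal.ofReal (n : ℝ)⁻¹ := by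
  refine iSup_le fun θ => ?_
  have hinv : (0 : ℝ) ≤ (n : ℝ)⁻¹ := by positivity
  have hsum : ∑ j, loss (Function.update z i x j) θ =
      ∑ j, loss (z j) θ + (loss x θ - loss (z i) θ) := by
    rw [← sub_eq_iff_eq_add', ← Finset.sum_sub_distrib, Finset.sum_eq_single i]
    · simp
    · intro j _ hj; simp [hj]
    · simp
  have habs : |loss x θ - loss (z i) θ| ≤ 1 :=
    abs_le.2 ⟨by linarith [(h01 x θ).1, (h01 (z i) θ).2],
      by linarith [(h01 x θ).2, (h01 (z i) θ).1]⟩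
  have h : |(n : ℝ)⁻¹ * ∑ j, loss (Function.update z i x j) θ - ∫ x, loss x θ ∂μ| ≤
      |(n : ℝ)⁻¹ * ∑ j, loss (z j) θ - ∫ x, loss x θ ∂μ| + (n : ℝ)⁻¹ := by
    rw [hsum, mul_add, add_sub_right_comm]
    refine (abs_add_le _ _).trans (add_le_add_right ?_ _)
    rw [abs_mul, abs_of_nonneg hinv]
    exact mul_le_of_le_one_right hinv habs
  refine (ENNReal.ofReal_le_ofReal h).trans ?_
  rw [ENNReal.ofReal_add (abs_nonneg _) hinv]
  exact add_le_add_left (le_iSup (fun θ => ENNReal.ofReal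
    |(n : ℝ)⁻¹ * ∑ j, loss (z j) θ - ∫ x, loss x θ ∂μ|) θ) _

section Symmetrization

variable {M Z : Type*} [MetricSpace Z] [MeasurableSpace Z] [BorelSpace Z] {loss : Z → M → ℝ}

theorem measurable_iSup_ofReal_abs {ι X : Type*} [TopologicalSpace X] [MeasurableSpace X]
    [OpensMeasurableSpace X] {f : ι → X → ℝ} (hf : ∀ i, Continuous (f i)) :
    Measurable fun x => ⨆ i, ENNReal.ofReal |f i x| :=
  (lowerSemicontinuous_iSup fun i =>
    (ENNReal.continuous_ofReal.comp (hf i).abs).lowerSemicontinuous).measurable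

theorem measurable_empiricalDeviation [SecondCountableTopology Z]
    (hc : ∀ θ, Continuous fun z => loss z θ) (μ : Measure Z)
    (n : ℕ) : Measurable (empiricalDeviation μ loss (n := n)) :=
  measurable_iSup_ofReal_abs fun θ => by
    have := hc θ
    fun_prop

theorem empiricalDeviation_le_lintegral (h01 : ∀ z θ, loss z θ ∈ Set.Icc (0 : ℝ) 1)
    (hc : ∀ θ, Continuous fun z => loss z θ) (μ : Measure Z) [IsProbabilityMeasure μ] {n : ℕ}
    (hn : 0 < n) (z : Fin n → Z) :
    empiricalDeviation μ loss z ≤ ∫⁻ z' : Fin n → Z,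
      ⨆ θ, ENNReal.ofReal |(n : ℝ)⁻¹ * ∑ j, (loss (z j) θ - loss (z' j) θ)|
        ∂(Measure.pi fun _ => μ) := by
  refine iSup_le fun θ => ?_
  have hi : Integrable (fun x => loss x θ) μ := Integrable.of_mem_Icc 0 1
    (hc θ).measurable.aemeasurable (Filter.Eventually.of_forall fun x => h01 x θ)
  have hij : ∀ j : Fin n, Integrable (fun z' : Fin n → Z => loss (z' j) θ)
      (Measure.pi fun _ => μ) := fun j => integrable_comp_eval (μ := fun _ : Fin n => μ) hi
  have hn' : (n : ℝ) ≠ 0 := by exact_mod_cast hn.ne'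
  have heq : (n : ℝ)⁻¹ * ∑ j, loss (z j) θ - ∫ x, loss x θ ∂μ =
      ∫ z' : Fin n → Z, (n : ℝ)⁻¹ * ∑ j, (loss (z j) θ - loss (z' j) θ)
        ∂(Measure.pi fun _ => μ) := by
    have hsub : ∀ j : Fin n, Integrable (fun z' : Fin n → Z => loss (z j) θ - loss (z' j) θ)
        (Measure.pi fun _ => μ) := fun j => (integrable_const _).sub (hij j)
    rw [integral_const_mul, integral_finsetSum _ fun j _ => hsub j]
    have : ∀ j : Fin n, ∫ z' : Fin n → Z, (loss (z j) θ - loss (z' j) θ)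
        ∂(Measure.pi fun _ => μ) = loss (z j) θ - ∫ x, loss x θ ∂μ := fun j => by
      rw [integral_sub (integrable_const _) (hij j),
        integral_comp_eval (μ := fun _ : Fin n => μ) (i := j) (f := fun x => loss x θ)
          hi.aestronglyMeasurable]
      simp
    simp only [this, Finset.sum_sub_distrib, Finset.sum_const, Finset.card_univ, Fintype.card_fin,
      nsmul_eq_mul]
    field_simp
  rw [heq, ← Real.norm_eq_abs, ofReal_norm]
  refine (enorm_integral_le_lintegral_enorm _).trans (lintegral_mono fun z' => ?_)
  rw [← ofReal_norm, Real.norm_eq_abs]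
  exact le_iSup (fun θ => ENNReal.ofReal |(n : ℝ)⁻¹ * ∑ j, (loss (z j) θ - loss (z' j) θ)|) θ

/-- Symmetrization: signs may be inserted in the difference of two independent samples. -/
theorem lintegral_sub_eq_lintegral_sign [SecondCountableTopology Z]
    (μ : Measure Z) [IsProbabilityMeasure μ] {n : ℕ}
    (hc : ∀ θ, Continuous fun z => loss z θ) (σ : Fin n → ℤˣ) :
    ∫⁻ w : Fin n → Z × Z,
        ⨆ θ, ENNReal.ofReal |(n : ℝ)⁻¹ * ∑ j, (loss (w j).1 θ - loss (w j).2 θ)|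
        ∂(Measure.pi fun _ => μ.prod μ) =
      ∫⁻ w : Fin n → Z × Z, ⨆ θ, ENNReal.ofReal
        |(n : ℝ)⁻¹ * ∑ j, (((σ j : ℤˣ) : ℤ) : ℝ) * (loss (w j).1 θ - loss (w j).2 θ)|
        ∂(Measure.pi fun _ => μ.prod μ) := by
  let s : Fin n → Z × Z → Z × Z := fun j => if σ j = 1 then id else Prod.swap
  have hs : ∀ j, MeasurePreserving (s j) (μ.prod μ) (μ.prod μ) := fun j => by
    by_cases h : σ j = 1
    · simpa [s, h] using MeasurePreserving.id _
    · simpa [s, h] using Measure.measurePreserving_swap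
  have hS := measurePreserving_pi (fun _ : Fin n => μ.prod μ) (fun _ => μ.prod μ) hs
  rw [← hS.lintegral_comp (measurable_iSup_ofReal_abs fun θ => by
    have := hc θ
    fun_prop)]
  refine lintegral_congr fun w => iSup_congr fun θ => ?_
  congr 3
  refine Finset.sum_congr rfl fun j _ => ?_
  rcases Int.units_eq_one_or (σ j) with h | h <;> simp [s, h]

theorem lintegral_empiricalDeviation_le [SecondCountableTopology Z]
    (h01 : ∀ z θ, loss z θ ∈ Set.Icc (0 : ℝ) 1)
    (hc : ∀ θ, Continuous fun z => loss z θ) (μ : Measure Z) [IsProbabilityMeasure μ] {n : ℕ}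
    (hn : 0 < n) :
    ∫⁻ z, empiricalDeviation μ loss z ∂(Measure.pi fun _ : Fin n => μ) ≤
      2 * (((2 : ℝ≥0∞) ^ n)⁻¹ * ∑ σ : Fin n → ℤˣ,
        ∫⁻ z : Fin n → Z, ⨆ θ' : M,
          ENNReal.ofReal |(n : ℝ)⁻¹ * ∑ j, (((σ j : ℤˣ) : ℤ) : ℝ) * loss (z j) θ'|
          ∂(Measure.pi fun _ => μ)) := by
  set R : (Fin n → ℤˣ) → ℝ≥0∞ := fun σ => ∫⁻ z : Fin n → Z, ⨆ θ' : M,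
    ENNReal.ofReal |(n : ℝ)⁻¹ * ∑ j, (((σ j : ℤˣ) : ℤ) : ℝ) * loss (z j) θ'|
    ∂(Measure.pi fun _ => μ)
  set Y : ℝ≥0∞ := ∫⁻ w : Fin n → Z × Z,
    ⨆ θ, ENNReal.ofReal |(n : ℝ)⁻¹ * ∑ j, (loss (w j).1 θ - loss (w j).2 θ)|
    ∂(Measure.pi fun _ => μ.prod μ) with hY
  have hm : ∀ σ : Fin n → ℤˣ, Measurable fun z : Fin n → Z => ⨆ θ' : M,
      ENNReal.ofReal |(n : ℝ)⁻¹ * ∑ j, (((σ j : ℤˣ) : ℤ) : ℝ) * loss (z j) θ'| := fun σ =>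
    measurable_iSup_ofReal_abs fun θ => by
      have := hc θ
      fun_prop
  have hX : ∫⁻ z, empiricalDeviation μ loss z ∂(Measure.pi fun _ : Fin n => μ) ≤ Y := by
    refine (lintegral_mono fun z => empiricalDeviation_le_lintegral h01 hc μ hn z).trans_eq ?_
    have hmY : Measurable fun p : (Fin n → Z) × (Fin n → Z) => ⨆ θ,
        ENNReal.ofReal |(n : ℝ)⁻¹ * ∑ j, (loss (p.1 j) θ - loss (p.2 j) θ)| :=
      measurable_iSup_ofReal_abs fun θ => by
        have := hc θ
        fun_prop
    rw [← lintegral_prod (μ := Measure.pi fun _ : Fin n => μ) _ hmY.aemeasurable,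
      ← (measurePreserving_arrowProdEquivProdArrow Z Z (Fin n) (fun _ => μ)
        (fun _ => μ)).lintegral_comp hmY]
    rfl
  have hσ : ∀ σ, Y ≤ 2 * R σ := by
    intro σ
    have h1 := measurePreserving_pi (fun _ : Fin n => μ.prod μ) (fun _ => μ)
      fun _ => measurePreserving_fst (μ := μ) (ν := μ)
    have h2 := measurePreserving_pi (fun _ : Fin n => μ.prod μ) (fun _ => μ)
      fun _ => measurePreserving_snd (μ := μ) (ν := μ)
    rw [hY, lintegral_sub_eq_lintegral_sign μ hc σ, two_mul]
    nth_rewrite 1 [show R σ = _ from (h1.lintegral_comp (hm σ)).symm]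
    rw [show R σ = _ from (h2.lintegral_comp (hm σ)).symm]
    refine le_trans ?_ (lintegral_add_left ((hm σ).comp h1.measurable) _).le
    refine lintegral_mono fun w => iSup_le fun θ => ?_
    simp only [mul_sub, Finset.sum_sub_distrib]
    refine (ENNReal.ofReal_le_ofReal (abs_sub _ _)).trans ?_
    rw [ENNReal.ofReal_add (abs_nonneg _) (abs_nonneg _)]
    exact add_le_add
      (le_iSup (fun θ => ENNReal.ofReal
        |(n : ℝ)⁻¹ * ∑ j, (((σ j : ℤˣ) : ℤ) : ℝ) * loss (w j).1 θ|) θ)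
      (le_iSup (fun θ => ENNReal.ofReal
        |(n : ℝ)⁻¹ * ∑ j, (((σ j : ℤˣ) : ℤ) : ℝ) * loss (w j).2 θ|) θ)
  refine hX.trans ?_
  have h2 : ((2 : ℝ≥0∞) ^ n) ≠ 0 := by simp
  have h2' : ((2 : ℝ≥0∞) ^ n) ≠ ∞ := by simp
  calc Y = ((2 : ℝ≥0∞) ^ n)⁻¹ * ∑ _σ : Fin n → ℤˣ, Y := by
        simp only [Finset.sum_const, Finset.card_univ, Fintype.card_fun, Fintype.card_units_int,
          Fintype.card_fin, nsmul_eq_mul, Nat.cast_pow, Nat.cast_ofNat]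
        rw [← mul_assoc, ENNReal.inv_mul_cancel h2 h2', one_mul]
    _ ≤ ((2 : ℝ≥0∞) ^ n)⁻¹ * ∑ σ : Fin n → ℤˣ, 2 * R σ := by gcongr; exact hσ _
    _ = 2 * (((2 : ℝ≥0∞) ^ n)⁻¹ * ∑ σ : Fin n → ℤˣ, R σ) := by
        rw [← Finset.mul_sum]; ring

theorem empiricalDeviation_le_one (h01 : ∀ z θ, loss z θ ∈ Set.Icc (0 : ℝ) 1)
    (hc : ∀ θ, Continuous fun z => loss z θ) (μ : Measure Z) [IsProbabilityMeasure μ] {n : ℕ}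
    (hn : 0 < n) (z : Fin n → Z) : empiricalDeviation μ loss z ≤ 1 := by
  refine iSup_le fun θ => ENNReal.ofReal_le_one.2 ?_
  have hi : Integrable (fun x => loss x θ) μ := Integrable.of_mem_Icc 0 1
    (hc θ).measurable.aemeasurable (Filter.Eventually.of_forall fun x => h01 x θ)
  have h0 : 0 ≤ ∫ x, loss x θ ∂μ := integral_nonneg fun x => (h01 x θ).1
  have h1 : ∫ x, loss x θ ∂μ ≤ 1 := by
    simpa using integral_mono hi (integrable_const (1 : ℝ)) fun x => (h01 x θ).2
  have hn' : (0 : ℝ) < n := by exact_mod_cast hn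
  have h0' : 0 ≤ (n : ℝ)⁻¹ * ∑ j, loss (z j) θ :=
    mul_nonneg (inv_nonneg.2 hn'.le) (Finset.sum_nonneg fun j _ => (h01 _ θ).1)
  have h1' : (n : ℝ)⁻¹ * ∑ j, loss (z j) θ ≤ 1 := by
    have : ∑ j, loss (z j) θ ≤ ∑ _j : Fin n, (1 : ℝ) := Finset.sum_le_sum fun j _ => (h01 _ θ).2
    rw [inv_mul_le_iff₀ hn']
    simpa using this
  exact abs_le.2 ⟨by linarith, by linarith⟩

/-- Uniform concentration of the empirical averages of `n` samples around their expectations, in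
terms of the complexity of the losses. -/
theorem measure_empiricalDeviation_gt_le [SecondCountableTopology Z]
    (h01 : ∀ z θ, loss z θ ∈ Set.Icc (0 : ℝ) 1)
    (hc : ∀ θ, Continuous fun z => loss z θ) {D : M → Measure Z}
    (hD : ∀ θ, IsProbabilityMeasure (D θ)) {C L γ : ℝ} (hC : 0 ≤ C) (hL : 0 ≤ L) (hγ : 0 < γ)
    (hR : rademacherComplexity D loss ≤ ENNReal.ofReal C) {n : ℕ} (hn : 0 < n)
    (hnγ : (2 * C + 3 * L) ^ 2 ≤ n * γ ^ 2) (θ : M) :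
    (Measure.pi fun _ : Fin n => D θ) {z | ENNReal.ofReal γ < empiricalDeviation (D θ) loss z} ≤
      ENNReal.ofReal (Real.exp (-(18 * L ^ 2))) := by
  have := hD θ
  have hn' : (0 : ℝ) < n := by exact_mod_cast hn
  have hsq : 0 < Real.sqrt n := Real.sqrt_pos.2 hn'
  have hfin : ∀ z : Fin n → Z, empiricalDeviation (D θ) loss z ≠ ∞ := fun z =>
    ((empiricalDeviation_le_one h01 hc _ hn z).trans_lt ENNReal.one_lt_top).ne
  let f : (Fin n → Z) → ℝ := fun z => (empiricalDeviation (D θ) loss z).toReal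
  have hmeas := measurable_empiricalDeviation hc (D θ) n
  have hmean : ∫ z, f z ∂(Measure.pi fun _ => D θ) ≤ 2 * C / Real.sqrt n := by
    rw [integral_toReal hmeas.aemeasurable
      (Filter.Eventually.of_forall fun z => (hfin z).lt_top)]
    refine ENNReal.toReal_le_of_le_ofReal (by positivity)
      ((lintegral_empiricalDeviation_le h01 hc (D θ) hn).trans ?_)
    have h := (le_iSup₂ (f := fun (θ : M) (n : ℕ) => ENNReal.ofReal (Real.sqrt n) *
      (((2 : ℝ≥0∞) ^ n)⁻¹ * ∑ σ : Fin n → ℤˣ,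
        ∫⁻ z : Fin n → Z, ⨆ θ' : M,
          ENNReal.ofReal |(n : ℝ)⁻¹ * ∑ j, (((σ j : ℤˣ) : ℤ) : ℝ) * loss (z j) θ'|
          ∂(Measure.pi fun _ => D θ))) θ n).trans hR
    rw [mul_comm, ← ENNReal.le_div_iff_mul_le (Or.inl (by simpa using hsq))
      (Or.inl ENNReal.ofReal_ne_top), ← ENNReal.ofReal_div_of_pos hsq] at h
    rw [mul_div_assoc, ENNReal.ofReal_mul zero_le_two, ENNReal.ofReal_ofNat]
    exact mul_le_mul_right h _
  have htail := measure_ge_le_of_boundedDiff (D θ) hn (f := f) hmeas.ennreal_toReal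
    (fun z => ⟨ENNReal.toReal_nonneg, by
      simpa using ENNReal.toReal_mono ENNReal.one_ne_top
        (empiricalDeviation_le_one h01 hc (D θ) hn z)⟩)
    (fun z i x => by
      have h := ENNReal.toReal_mono (ENNReal.add_ne_top.2 ⟨hfin z, ENNReal.ofReal_ne_top⟩)
        (empiricalDeviation_update_le h01 (D θ) z i x)
      rwa [ENNReal.toReal_add (hfin z) ENNReal.ofReal_ne_top,
        ENNReal.toReal_ofReal (by positivity)] at h)
    (u := 3 * L / Real.sqrt n) (by positivity)
  have hexp : 2 * (n : ℝ) * (3 * L / Real.sqrt n) ^ 2 = 18 * L ^ 2 := by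
    rw [div_pow, Real.sq_sqrt hn'.le]; field_simp; ring
  rw [hexp] at htail
  have hγ' : (2 * C + 3 * L) / Real.sqrt n ≤ γ := by
    rw [div_le_iff₀ hsq]
    refine le_of_sq_le_sq ?_ (by positivity)
    rw [mul_pow, Real.sq_sqrt hn'.le]
    linarith
  refine (measure_mono fun z hz => ?_).trans
    ((ofReal_measureReal (by finiteness)).symm.trans_le (ENNReal.ofReal_le_ofReal htail))
  simp only [Set.mem_ofPred_eq] at hz ⊢
  refine le_trans ?_ ((ENNReal.ofReal_lt_iff_lt_toReal hγ.le (hfin z)).1 hz).le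
  rw [add_div] at hγ'
  linarith

end Symmetrization

theorem DPR_mem_Icc {M Z : Type*} [TopologicalSpace Z] [MeasurableSpace Z] [OpensMeasurableSpace Z]
    {D : M → Measure Z} {loss : Z → M → ℝ} (hD : ∀ θ, IsProbabilityMeasure (D θ))
    (h01 : ∀ z θ, loss z θ ∈ Set.Icc (0 : ℝ) 1) (hc : ∀ θ, Continuous fun z => loss z θ)
    (θ θ' : M) : DPR D loss θ θ' ∈ Set.Icc (0 : ℝ) 1 := by
  have := hD θ
  have hi : Integrable (fun x => loss x θ') (D θ) := Integrable.of_mem_Icc 0 1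
    (hc θ').measurable.aemeasurable (Filter.Eventually.of_forall fun x => h01 x θ')
  exact ⟨integral_nonneg fun x => (h01 x θ').1, by
    simpa [DPR] using integral_mono hi (integrable_const (1 : ℝ)) fun x => (h01 x θ').2⟩

theorem gap_eq {M Z : Type*} [MeasurableSpace Z] {D : M → Measure Z} {loss : Z → M → ℝ} {θPO : M}
    (hPO : ∀ θ, PR D loss θPO ≤ PR D loss θ) (θ : M) :
    gap D loss θ = PR D loss θ - PR D loss θPO := by
  have : Nonempty M := ⟨θPO⟩
  rw [gap, le_antisymm (ciInf_le ⟨_, by rintro _ ⟨x, rfl⟩; exact hPO x⟩ θPO) (le_ciInf hPO)]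

/-- The confidence bounds leave every model of small suboptimality alive. -/
theorem survives_of_gap_le {M Z : Type*} [PseudoMetricSpace M] [MeasurableSpace Z] {D : M → Measure Z}
    {loss : Z → M → ℝ} {α s : ℝ} {θPO : M} (hPO : ∀ θ, PR D loss θPO ≤ PR D loss θ)
    (hLip : ∀ θ₁ θ₂ θ, DPR D loss θ₁ θ - DPR D loss θ₂ θ ≤ α * dist θ₁ θ₂) (S : Finset M)
    (π : S ≃ Fin S.card) (θ : S) (h : gap D loss θ ≤ 4 * α * s) : Survives D loss α s S π θ := by
  have h1 : lowerBound (DPR D loss) α (earlier S π θ) θ ≤ ((PR D loss θ : ℝ) : EReal) :=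
    iSup₂_le fun θ' _ => by
      have := hLip θ' θ θ
      rw [dist_comm] at this
      rw [EReal.coe_le_coe_iff, PR]
      linarith
  have h2 : ((PR D loss θPO : ℝ) : EReal) ≤ upperMin (DPR D loss) α (earlier S π θ) :=
    le_iInf fun x => le_iInf₂ fun θ' _ => by
      have h3 := hLip x θ' x
      have h4 := hPO x
      rw [dist_comm] at h3
      rw [EReal.coe_le_coe_iff]
      rw [PR, PR] at h4
      rw [PR]
      linarith
  refine (iInf₂_le (θ : M) (by simp [ball])).trans (h1.trans ?_)
  refine le_trans ?_ (add_le_add_left h2 _)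
  rw [← EReal.coe_add, EReal.coe_le_coe_iff]
  rw [gap_eq hPO] at h
  linarith

/-- The decoupled performative risk is Lipschitz in the deployed model. -/
theorem DPR_sub_le {M Z : Type*} [PseudoMetricSpace M] [MetricSpace Z] [SecondCountableTopology Z]
    [MeasurableSpace Z] [BorelSpace Z] {D : M → Measure Z} {loss : Z → M → ℝ}
    (hD : ∀ θ, IsProbabilityMeasure (D θ))
    (h01 : ∀ z θ, loss z θ ∈ Set.Icc (0 : ℝ) 1) {Lz ε : ℝ≥0}
    (hLip : ∀ θ, LipschitzWith Lz fun z => loss z θ) (hsens : IsSensitive D ε) (θ₁ θ₂ θ : M) :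
    DPR D loss θ₁ θ - DPR D loss θ₂ θ ≤ Lz * ε * dist θ₁ θ₂ := by
  have hcoup : ENNReal.ofReal (DPR D loss θ₁ θ - DPR D loss θ₂ θ) / Lz ≤
      wasserstein1 (D θ₁) (D θ₂) := by
    refine le_iInf fun π => le_iInf fun h1 => le_iInf fun h2 => ENNReal.div_le_of_le_mul' ?_
    have hprob : IsProbabilityMeasure π := by
      have := hD θ₁
      refine ⟨?_⟩
      rw [← Measure.fst_univ, h1, measure_univ]
    have hm := (hLip θ).continuous.measurable
    have hi1 : Integrable (fun p : Z × Z => loss p.1 θ) π := Integrable.of_mem_Icc 0 1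
      (hm.comp measurable_fst).aemeasurable (Filter.Eventually.of_forall fun x => h01 _ θ)
    have hi2 : Integrable (fun p : Z × Z => loss p.2 θ) π := Integrable.of_mem_Icc 0 1
      (hm.comp measurable_snd).aemeasurable (Filter.Eventually.of_forall fun x => h01 _ θ)
    have e1 : DPR D loss θ₁ θ = ∫ p, loss p.1 θ ∂π := by
      rw [DPR, ← h1, Measure.fst, integral_map measurable_fst.aemeasurable
        hm.aestronglyMeasurable]
    have e2 : DPR D loss θ₂ θ = ∫ p, loss p.2 θ ∂π := by
      rw [DPR, ← h2, Measure.snd, integral_map measurable_snd.aemeasurable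
        hm.aestronglyMeasurable]
    rw [e1, e2, ← integral_sub hi1 hi2, ← lintegral_const_mul _ (by fun_prop)]
    refine (ENNReal.ofReal_le_ofReal (le_abs_self _)).trans ?_
    rw [← Real.norm_eq_abs, ofReal_norm]
    refine (enorm_integral_le_lintegral_enorm _).trans (lintegral_mono fun p => ?_)
    rw [← edist_eq_enorm_sub]
    exact hLip θ p.1 p.2
  have h := hcoup.trans (hsens θ₁ θ₂)
  have hne : (ε : ℝ≥0∞) * edist θ₁ θ₂ ≠ ∞ := ENNReal.mul_ne_top ENNReal.coe_ne_top (edist_ne_top _ _)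
  rw [ENNReal.div_le_iff_le_mul (Or.inr hne) (Or.inl ENNReal.coe_ne_top)] at h
  refine (ENNReal.ofReal_le_ofReal_iff (by positivity)).1 (h.trans_eq ?_)
  rw [ENNReal.ofReal_mul (by positivity), ENNReal.ofReal_mul (by positivity), edist_dist,
    ENNReal.ofReal_coe_nnreal, ENNReal.ofReal_coe_nnreal]
  ring

section Covers

/-- The number of points at distances larger than `r` in a ball of radius `17 r` is bounded in terms
of the dimension. -/
theorem exists_packing_bound (n : ℕ) : ∃ m : ℕ, ∀ (Θ : Set (EuclideanSpace ℝ (Fin n))) (r : ℝ≥0∞),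
    r ≠ 0 → ∀ (c : Θ) (Q : Finset Θ), (∀ x ∈ Q, edist x c ≤ 17 * r) →
      (∀ x ∈ Q, ∀ y ∈ Q, x ≠ y → r < edist x y) → Q.card ≤ m := by
  obtain ⟨t, -, htf, htc⟩ := (isCompact_closedBall (0 : EuclideanSpace ℝ (Fin n)) 17).finite_cover_balls
    (e := 1 / 2) (by norm_num)
  refine ⟨max 1 htf.toFinset.card, fun Θ r hr c Q hc hsep => ?_⟩
  by_cases hr' : r = ∞
  · refine le_max_of_le_left (Finset.card_le_one.2 fun x hx y hy => ?_)
    by_contra hne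
    exact not_top_lt (hr' ▸ hsep x hx y hy hne)
  refine le_max_of_le_right ?_
  have hs : 0 < r.toReal := ENNReal.toReal_pos hr hr'
  have hex : ∀ x : Θ, ∃ y, x ∈ Q → y ∈ t ∧
      dist (r.toReal⁻¹ • ((x : EuclideanSpace ℝ (Fin n)) - c)) y < 1 / 2 := by
    intro x
    by_cases hx : x ∈ Q
    · have hxc : dist x c ≤ 17 * r.toReal := by
        have := ENNReal.toReal_mono (ENNReal.mul_ne_top (by simp) hr') (hc x hx)
        simpa [dist_edist] using this
      have : r.toReal⁻¹ • ((x : EuclideanSpace ℝ (Fin n)) - c) ∈ Metric.closedBall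
          (0 : EuclideanSpace ℝ (Fin n)) 17 := by
        rw [mem_closedBall_zero_iff, norm_smul, norm_inv, Real.norm_of_nonneg hs.le, ← dist_eq_norm,
          inv_mul_le_iff₀ hs, mul_comm]
        exact hxc
      obtain ⟨y, hy, hxy⟩ := Set.mem_iUnion₂.1 (htc this)
      exact ⟨y, fun _ => ⟨hy, hxy⟩⟩
    · exact ⟨0, fun h => absurd h hx⟩
  choose g hg using hex
  refine Finset.card_le_card_of_injOn g (fun x hx => by simpa using (hg x hx).1) fun x hx y hy hxy => ?_
  by_contra hne
  have h1 := (hg x hx).2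
  have h2 := (hg y hy).2
  rw [← hxy, dist_comm] at h2
  have h3 := dist_triangle_left (r.toReal⁻¹ • ((x : EuclideanSpace ℝ (Fin n)) - c))
    (r.toReal⁻¹ • ((y : EuclideanSpace ℝ (Fin n)) - c)) (g x)
  rw [dist_comm (g x) (r.toReal⁻¹ • ((x : EuclideanSpace ℝ (Fin n)) - c)), dist_smul₀, dist_sub_right, norm_inv, Real.norm_of_nonneg hs.le] at h3
  have h4 : r.toReal < dist x y := by
    have := hsep x hx y hy hne
    rw [edist_dist, ENNReal.lt_ofReal_iff_toReal_lt hr'] at this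
    exact this
  have h5 : 1 < r.toReal⁻¹ * dist x y := by
    rwa [lt_inv_mul_iff₀ hs, mul_one]
  rw [Subtype.dist_eq] at h5
  linarith

/-- A set whose separated subsets have at most `m` points has a cover with at most `m` points. -/
theorem exists_cover_card_le {M : Type*} [PseudoEMetricSpace M] {r : ℝ≥0∞} {A : Set M} {m : ℕ}
    (h : ∀ Q : Finset M, (Q : Set M) ⊆ A → (∀ x ∈ Q, ∀ y ∈ Q, x ≠ y → r < edist x y) →
      Q.card ≤ m) : ∃ S, IsCoverOf r A S ∧ S.card ≤ m := by
  classical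
  let P : ℕ → Prop := fun k => ∃ Q : Finset M, (Q : Set M) ⊆ A ∧
    (∀ x ∈ Q, ∀ y ∈ Q, x ≠ y → r < edist x y) ∧ Q.card = k
  have hP : P (Nat.findGreatest P m) :=
    Nat.findGreatest_spec (Nat.zero_le m) ⟨∅, by simp⟩
  obtain ⟨Q, hQA, hQs, hQc⟩ := hP
  refine ⟨Q, ⟨hQA, fun θ hθ => ?_⟩, h Q hQA hQs⟩
  by_contra hno
  push Not at hno
  have hlt : ∀ c ∈ Q, r < edist θ c := fun c hc => not_le.1 (hno c hc)
  have hnot : θ ∉ Q := fun hmem => by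
    have := hlt θ hmem
    simp at this
  have hP' : P (Q.card + 1) := by
    refine ⟨insert θ Q, ?_, ?_, Finset.card_insert_of_notMem hnot⟩
    · rw [Finset.coe_insert]
      exact Set.insert_subset hθ hQA
    · intro x hx y hy hxy
      rcases Finset.mem_insert.1 hx with hxθ | hxQ <;> rcases Finset.mem_insert.1 hy with hyθ | hyQ
      · exact absurd (hxθ.trans hyθ.symm) hxy
      · exact hxθ ▸ hlt y hyQ
      · rw [edist_comm, hyθ]; exact hlt x hxQ
      · exact hQs x hxQ y hyQ hxy
  have hle : Q.card + 1 ≤ m := by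
    obtain ⟨Q', h1, h2, h3⟩ := hP'
    exact h3 ▸ h Q' h1 h2
  have := Nat.le_findGreatest hle hP'
  omega

open Classical in
/-- A minimal cover has a bounded number of points in a ball of comparable radius, because these
could be exchanged for a maximal separated set. -/
theorem IsMinimalCover.card_filter_le {M : Type*} [PseudoEMetricSpace M] {r : ℝ≥0∞} {m : ℕ} (c : M)
    (hm : ∀ Q : Finset M, (∀ x ∈ Q, edist x c ≤ 17 * r) →
      (∀ x ∈ Q, ∀ y ∈ Q, x ≠ y → r < edist x y) → Q.card ≤ m)
    {A : Set M} {S : Finset M} (hS : IsMinimalCover r A S) :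
    (S.filter fun x => edist x c ≤ 16 * r).card ≤ m := by
  obtain ⟨⟨hSA, hcov⟩, hmin⟩ := hS
  obtain ⟨Q, ⟨hQA, hQc⟩, hQm⟩ := exists_cover_card_le (r := r)
    (A := {x ∈ A | edist x c ≤ 17 * r}) (m := m) fun Q hQ hs => hm Q (fun x hx => (hQ hx).2) hs
  have h := hmin (S.filter (fun x => ¬ edist x c ≤ 16 * r) ∪ Q) ⟨by
    intro x hx
    rcases Finset.mem_union.1 hx with hx | hx
    · exact hSA (Finset.mem_filter.1 hx).1
    · exact (hQA hx).1, fun θ hθ => by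
    obtain ⟨s, hs, hsθ⟩ := hcov θ hθ
    by_cases hsc : edist s c ≤ 16 * r
    · obtain ⟨q, hq, hqθ⟩ := hQc θ ⟨hθ, by
        calc edist θ c ≤ edist θ s + edist s c := edist_triangle _ _ _
          _ ≤ r + 16 * r := add_le_add hsθ hsc
          _ = 17 * r := by ring⟩
      exact ⟨q, Finset.mem_union_right _ hq, hqθ⟩
    · exact ⟨s, Finset.mem_union_left _ (Finset.mem_filter.2 ⟨hs, hsc⟩), hsθ⟩⟩
  have h1 := Finset.card_union_le (S.filter fun x => ¬ edist x c ≤ 16 * r) Q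
  have h2 := Finset.card_filter_add_card_filter_not (s := S) fun x => edist x c ≤ 16 * r
  omega

/-- A finite set has minimal covers. -/
theorem exists_isMinimalCover {M : Type*} [PseudoEMetricSpace M] (r : ℝ≥0∞) (B : Finset M) :
    ∃ S, IsMinimalCover r (B : Set M) S := by
  classical
  have hex : ∃ k, ∃ S : Finset M, IsCoverOf r (B : Set M) S ∧ S.card = k :=
    ⟨_, B, ⟨subset_rfl, fun θ hθ => ⟨θ, hθ, by simp [ball]⟩⟩, rfl⟩
  obtain ⟨S, hS, hc⟩ := Nat.find_spec hex
  exact ⟨S, hS, fun S' hS' => hc ▸ Nat.find_min' hex ⟨S', hS', rfl⟩⟩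

end Covers

section Zooming

variable {M Z : Type*} [PseudoMetricSpace M] [MeasurableSpace Z] {D : M → Measure Z}
  {loss : Z → M → ℝ}

open Classical in
theorem expectedSurvivors_eq_card {α r s : ℝ} {S : Finset M}
    (h : ∀ π : S ≃ Fin S.card, ∀ θ : S, 16 * α * r ≤ gap D loss θ ∧ gap D loss θ < 32 * α * r ∧
      Survives D loss α s S π θ) : expectedSurvivors D loss α r s S = S.card := by
  have hne : Nonempty (S ≃ Fin S.card) := ⟨S.equivFin⟩
  have hf : ∀ π : S ≃ Fin S.card, (Finset.univ.filter fun θ : S =>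
      16 * α * r ≤ gap D loss θ ∧ gap D loss θ < 32 * α * r ∧
        Survives D loss α s S π θ).card = S.card := fun π => by
    rw [Finset.filter_true_of_mem fun θ _ => h π θ]
    simp
  have hc : (Fintype.card (S ≃ Fin S.card) : ℝ) ≠ 0 := by
    exact_mod_cast Fintype.card_ne_zero
  rw [expectedSurvivors]
  simp only [hf, Finset.sum_const, Finset.card_univ, nsmul_eq_mul]
  rw [inv_mul_cancel_left₀ hc]

open Classical in
/-- In a minimal `s`-cover, the number of points in each suboptimality band is bounded by the
zooming dimension at the scale `8 s`, where no point of the band is ever discarded. -/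
theorem card_band_le {m : ℕ}
    (hpack : ∀ r : ℝ≥0∞, r ≠ 0 → ∀ (c : M) (Q : Finset M), (∀ x ∈ Q, edist x c ≤ 17 * r) →
      (∀ x ∈ Q, ∀ y ∈ Q, x ≠ y → r < edist x y) → Q.card ≤ m)
    {θPO : M} (hPO : ∀ θ, PR D loss θPO ≤ PR D loss θ)
    {α d c : ℝ} (hα : 0 ≤ α)
    (hLip : ∀ θ₁ θ₂ θ, DPR D loss θ₁ θ - DPR D loss θ₂ θ ≤ α * dist θ₁ θ₂)
    (hzoom : HasSeqZoomingDim D loss α d c) {r s : ℝ} (hr : 0 < r) (hrs : r ≤ s) (hs : 8 * s ≤ 1)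
    {A : Set M} {S : Finset M} (hS : IsMinimalCover (ENNReal.ofReal s) A S) :
    ((S.filter fun θ => 16 * α * r ≤ gap D loss θ ∧ gap D loss θ < 32 * α * r).card : ℝ) ≤
      m * (c * (3 / (8 * s)) ^ d) := by
  set B := S.filter fun θ => 16 * α * r ≤ gap D loss θ ∧ gap D loss θ < 32 * α * r with hB
  have hs0 : 0 < s := hr.trans_le hrs
  have hαrs : α * r ≤ α * s := mul_le_mul_of_nonneg_left hrs hα
  have hαs : 0 ≤ α * s := mul_nonneg hα hs0.le
  obtain ⟨S', hS'⟩ := exists_isMinimalCover (ENNReal.ofReal (8 * s)) B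
  have hband : ∀ θ ∈ B, 16 * α * r ≤ gap D loss θ ∧ gap D loss θ < 32 * α * r := fun θ hθ =>
    (Finset.mem_filter.1 hθ).2
  have h := hzoom r (8 * s) hr (by linarith) hs B
    (fun θ hθ => by nlinarith [(hband θ hθ).2]) S' hS'
  rw [expectedSurvivors_eq_card fun π θ => ?_] at h
  · have hsub : B ⊆ S'.biUnion fun c => S.filter fun x => edist x c ≤ 16 * ENNReal.ofReal s := by
      intro θ hθ
      obtain ⟨c, hc, hcθ⟩ := hS'.1.2 θ hθ
      refine Finset.mem_biUnion.2 ⟨c, hc, Finset.mem_filter.2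
        ⟨(Finset.mem_filter.1 hθ).1, le_trans (show edist θ c ≤ _ from hcθ) ?_⟩⟩
      rw [ENNReal.ofReal_mul (by norm_num), ENNReal.ofReal_ofNat]
      gcongr
      norm_num
    have hcard : B.card ≤ S'.card * m := (Finset.card_le_card hsub).trans
      (Finset.card_biUnion_le_card_mul _ _ _ fun c _ => hS.card_filter_le c
        (hpack _ (by simpa using hs0) c))
    calc (B.card : ℝ) ≤ S'.card * m := by exact_mod_cast hcard
      _ ≤ c * (3 / (8 * s)) ^ d * m := by gcongr
      _ = _ := mul_comm _ _
  · have hθ := hband θ (hS'.1.1 θ.2)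
    exact ⟨hθ.1, hθ.2, survives_of_gap_le hPO hLip _ _ _ (by nlinarith [hθ.2])⟩

/-- The total suboptimality of a minimal cover of a set of models of small suboptimality. -/
theorem sum_gap_le {m : ℕ}
    (hpack : ∀ r : ℝ≥0∞, r ≠ 0 → ∀ (c : M) (Q : Finset M), (∀ x ∈ Q, edist x c ≤ 17 * r) →
      (∀ x ∈ Q, ∀ y ∈ Q, x ≠ y → r < edist x y) → Q.card ≤ m)
    {θPO : M} (hPO : ∀ θ, PR D loss θPO ≤ PR D loss θ)
    (hdiam : ∀ x y : M, edist x y ≤ 2) {α : ℝ≥0} {d c : ℝ} (hd : 0 ≤ d)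
    (hLip : ∀ θ₁ θ₂ θ, DPR D loss θ₁ θ - DPR D loss θ₂ θ ≤ α * dist θ₁ θ₂)
    (hzoom : HasSeqZoomingDim D loss α d c) {γ : ℝ} (hγ : 0 < γ)
    {A : Set M} (hA : ∀ θ ∈ A, gap D loss θ ≤ 16 * γ) {S : Finset M}
    (hS : IsMinimalCover (ENNReal.ofReal γ / α) A S) :
    ∑ θ ∈ S, gap D loss θ ≤ m * (16 + 64 * |c| * 3 ^ d) * (γ * (1 + (α / γ) ^ d)) := by
  have hSA : ∀ θ ∈ S, gap D loss θ ≤ 16 * γ := fun θ hθ => hA θ (hS.1.1 hθ)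
  have hpow : 0 ≤ ((α : ℝ) / γ) ^ d := by positivity
  have h3 : (0 : ℝ) ≤ 3 ^ d := by positivity
  have hmnn : (0 : ℝ) ≤ m := Nat.cast_nonneg m
  rcases lt_or_ge (α : ℝ) (8 * γ) with hlt | hge
  · have hcard : S.card ≤ m := by
      rcases S.eq_empty_or_nonempty with rfl | ⟨x₀, hx₀⟩
      · simp
      have h := hS.card_filter_le x₀ (hpack _ (ENNReal.div_ne_zero.2
        ⟨by simpa using hγ, ENNReal.coe_ne_top⟩) x₀)
      rwa [Finset.filter_true_of_mem fun x _ => (hdiam x x₀).trans ?_] at h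
      rw [← mul_div_assoc, ENNReal.le_div_iff_mul_le (Or.inr (by simp [hγ])) (Or.inl ENNReal.coe_ne_top),
        ← ENNReal.ofReal_coe_nnreal, ← ENNReal.ofReal_ofNat, ← ENNReal.ofReal_ofNat,
        ← ENNReal.ofReal_mul (by norm_num), ← ENNReal.ofReal_mul (by norm_num)]
      exact ENNReal.ofReal_le_ofReal (by linarith)
    calc ∑ θ ∈ S, gap D loss θ ≤ S.card * (16 * γ) := by
          simpa using Finset.sum_le_card_nsmul S _ _ hSA
      _ ≤ m * (16 * γ) := by gcongr
      _ = m * (16 + 0) * (γ * (1 + 0)) := by ring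
      _ ≤ _ := by gcongr; positivity
  have hα : 0 < (α : ℝ) := by linarith
  set s : ℝ := γ / α with hsdef
  have hs : 0 < s := div_pos hγ hα
  have hs8 : 8 * s ≤ 1 := by rw [hsdef, ← mul_div_assoc, div_le_one hα]; exact hge
  have hαs : α * s = γ := mul_div_cancel₀ _ hα.ne'
  have hS' : IsMinimalCover (ENNReal.ofReal s) A S := by
    rwa [hsdef, ENNReal.ofReal_div_of_pos hα, ENNReal.ofReal_coe_nnreal]
  have hgap0 : ∀ θ, 0 ≤ gap D loss θ := fun θ => by rw [gap_eq hPO]; linarith [hPO θ]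
  have hex : ∀ θ, ∃ j : ℕ, θ ∈ S → 0 < gap D loss θ →
      16 * α * (s * (1 / 2) ^ j) ≤ gap D loss θ ∧ gap D loss θ < 32 * α * (s * (1 / 2) ^ j) := by
    intro θ
    by_cases hθ : θ ∈ S ∧ 0 < gap D loss θ
    · have hj : ∃ j : ℕ, 16 * γ * (1 / 2) ^ j ≤ gap D loss θ := by
        obtain ⟨j, hj⟩ := exists_pow_lt_of_lt_one (div_pos hθ.2 (by positivity : 0 < 16 * γ))
          (by norm_num : (1 / 2 : ℝ) < 1)
        exact ⟨j, by rw [lt_div_iff₀ (by positivity)] at hj; linarith⟩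
      refine ⟨Nat.find hj, fun _ _ => ⟨?_, ?_⟩⟩
      · rw [mul_assoc, ← mul_assoc (α : ℝ), hαs, ← mul_assoc]
        exact Nat.find_spec hj
      · rw [mul_assoc, ← mul_assoc (α : ℝ), hαs]
        rcases hk : Nat.find hj with _ | k
        · have := hSA θ hθ.1
          simp only [pow_zero]
          linarith
        · have := Nat.find_min hj (m := k) (by omega)
          rw [pow_succ]
          linarith
    · exact ⟨0, fun h1 h2 => absurd ⟨h1, h2⟩ hθ⟩
  choose j hj using hex
  set b : ℝ := |c| * 3 ^ d * (α / γ) ^ d with hb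
  have hb0 : 0 ≤ b := by positivity
  have hcb : c * (3 / (8 * s)) ^ d ≤ b := by
    have h1 : (3 / (8 * s)) ^ d ≤ (3 * (α / γ)) ^ d := by
      refine Real.rpow_le_rpow (by positivity) ?_ hd
      rw [hsdef, div_le_iff₀ (by positivity)]
      field_simp
      norm_num
    calc c * (3 / (8 * s)) ^ d ≤ |c| * (3 * (α / γ)) ^ d :=
          mul_le_mul (le_abs_self c) h1 (by positivity) (abs_nonneg c)
      _ = b := by rw [Real.mul_rpow (by norm_num) (by positivity), hb]; ring
  set S₁ := S.filter fun θ => 0 < gap D loss θ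
  set J := S₁.sup j + 1
  have hmaps : ∀ θ ∈ S₁, j θ ∈ Finset.range J := fun θ hθ =>
    Finset.mem_range.2 (Nat.lt_succ_of_le (Finset.le_sup hθ))
  have hfib : ∀ i ∈ Finset.range J, ∑ θ ∈ S₁ with j θ = i, gap D loss θ ≤
      m * b * (32 * γ) * (1 / 2) ^ i := by
    intro i _
    set B := S.filter fun θ => 16 * α * (s * (1 / 2) ^ i) ≤ gap D loss θ ∧
      gap D loss θ < 32 * α * (s * (1 / 2) ^ i)
    have hsub : (S₁.filter fun θ => j θ = i) ⊆ B := by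
      intro θ hθ
      obtain ⟨hθ1, rfl⟩ := Finset.mem_filter.1 hθ
      obtain ⟨hθS, hθ0⟩ := Finset.mem_filter.1 hθ1
      exact Finset.mem_filter.2 ⟨hθS, hj θ hθS hθ0⟩
    have hcard : (B.card : ℝ) ≤ m * b := (card_band_le hpack hPO hα.le hLip hzoom
      (by positivity) (mul_le_of_le_one_right hs.le (pow_le_one₀ (by norm_num) (by norm_num))) hs8
      hS').trans (mul_le_mul_of_nonneg_left hcb hmnn)
    calc ∑ θ ∈ S₁ with j θ = i, gap D loss θ ≤ ∑ θ ∈ B, gap D loss θ :=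
          Finset.sum_le_sum_of_subset_of_nonneg hsub fun θ _ _ => hgap0 θ
      _ ≤ B.card * (32 * γ * (1 / 2) ^ i) := by
          have := Finset.sum_le_card_nsmul B (fun θ => gap D loss θ) (32 * γ * (1 / 2) ^ i)
            fun θ hθ => by
              have h := (Finset.mem_filter.1 hθ).2.2.le
              rw [mul_assoc, ← mul_assoc (α : ℝ), hαs] at h
              linarith
          simpa using this
      _ ≤ m * b * (32 * γ * (1 / 2) ^ i) := by gcongr
      _ = _ := by ring
  calc ∑ θ ∈ S, gap D loss θ = ∑ θ ∈ S₁, gap D loss θ := by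
        refine (Finset.sum_filter_of_ne fun θ _ hne => ?_).symm
        exact lt_of_le_of_ne (hgap0 θ) hne.symm
    _ = ∑ i ∈ Finset.range J, ∑ θ ∈ S₁ with j θ = i, gap D loss θ :=
        (Finset.sum_fiberwise_of_maps_to hmaps _).symm
    _ ≤ ∑ i ∈ Finset.range J, m * b * (32 * γ) * (1 / 2) ^ i := Finset.sum_le_sum hfib
    _ = m * b * (32 * γ) * ∑ i ∈ Finset.range J, (1 / 2 : ℝ) ^ i := by rw [Finset.mul_sum]
    _ ≤ m * b * (32 * γ) * 2 := by
        gcongr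
        rw [geom_sum_eq (by norm_num)]
        have : (0 : ℝ) ≤ (1 / 2) ^ J := by positivity
        rw [div_le_iff_of_neg (by norm_num)]
        linarith
    _ = m * (0 + 64 * |c| * 3 ^ d) * (γ * (0 + (α / γ) ^ d)) := by rw [hb]; ring
    _ ≤ _ := by gcongr <;> norm_num

end Zooming

theorem tol_pos (p : ℕ) : 0 < tol p := by unfold tol; positivity

theorem tol_succ (p : ℕ) : tol p = 2 * tol (p + 1) := by unfold tol; rw [pow_succ]; ring

theorem tol_antitone {p q : ℕ} (h : p ≤ q) : tol q ≤ tol p :=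
  pow_le_pow_of_le_one (by norm_num) (by norm_num) h

theorem Input.mul_dist_le_of_mem_ball {M : Type*} [PseudoMetricSpace M] {I : Input} {p : ℕ}
    {x c : M} (h : x ∈ ball (I.radius p) c) : I.Lz * I.ε * dist x c ≤ tol p := by
  have h1 := ENNReal.mul_le_of_le_div (show edist x c ≤ _ from h)
  rw [edist_dist, ← ENNReal.ofReal_coe_nnreal, ← ENNReal.ofReal_mul dist_nonneg,
    ENNReal.ofReal_le_ofReal_iff (tol_pos p).le, mul_comm] at h1
  simpa using h1

open Classical in
theorem State.update_net_subset {M Z : Type*} [PseudoMetricSpace M] {loss : Z → M → ℝ} {I : Input}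
    (σ : State M) (θ : M) (z : Fin (I.steps σ.phase * I.m₀) → Z) :
    (σ.update loss I θ z).net ⊆ σ.net.erase θ := Finset.filter_subset _ _

theorem State.update_active_subset {M Z : Type*} [PseudoMetricSpace M] {loss : Z → M → ℝ}
    {I : Input} (σ : State M) (θ : M)
    (z : Fin (I.steps σ.phase * I.m₀) → Z) : (σ.update loss I θ z).active ⊆ σ.active :=
  Set.sdiff_subset

section Invariant

variable {M Z : Type*} [PseudoMetricSpace M] [MeasurableSpace Z]

/-- The properties of the states that are reached as long as all estimates are accurate. -/
structure State.Regular (D : M → Measure Z) (loss : Z → M → ℝ) (I : Input) (θPO : M)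
    (σ : State M) : Prop where
  opt_mem : θPO ∈ σ.active
  gap_le : ∀ x ∈ σ.active, gap D loss x ≤ 16 * tol σ.phase
  net_gap_le : ∀ θ ∈ σ.net, gap D loss θ ≤ 16 * tol σ.phase
  cover : ∀ x ∈ σ.active, ∃ c, (c ∈ σ.net ∨ c ∈ σ.deployed) ∧ x ∈ ball (I.radius σ.phase) c
  est_close : ∀ c ∈ σ.deployed, ∀ θ, |σ.est c θ - DPR D loss c θ| ≤ tol σ.phase
  net_nonempty : σ.net.Nonempty

variable {D : M → Measure Z} {loss : Z → M → ℝ} {I : Input} {N : ℕ → Set M → Finset M} {θPO : M}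

theorem State.regular_start (hN : ∀ p A, IsMinimalCover (I.radius p) A (N p A)) {p : ℕ} {A : Set M}
    (hmem : θPO ∈ A) (hgap : ∀ x ∈ A, gap D loss x ≤ 16 * tol p) :
    (State.start N p A).Regular D loss I θPO where
  opt_mem := hmem
  gap_le := hgap
  net_gap_le θ hθ := hgap θ ((hN p A).1.1 hθ)
  cover x hx := by
    obtain ⟨c, hc, hxc⟩ := (hN p A).1.2 x hx
    exact ⟨c, Or.inl hc, hxc⟩
  est_close c hc := by simp [State.start] at hc
  net_nonempty := by
    obtain ⟨c, hc, -⟩ := (hN p A).1.2 θPO hmem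
    exact ⟨c, hc⟩

section Bounds

variable {est : M → M → ℝ} {α γ : ℝ} {P : Finset M}

theorem lowerBound_le_of_close
    (hLip : ∀ θ₁ θ₂ θ, DPR D loss θ₁ θ - DPR D loss θ₂ θ ≤ α * dist θ₁ θ₂)
    (hest : ∀ c ∈ P, ∀ θ, |est c θ - DPR D loss c θ| ≤ γ) (x : M) :
    lowerBound est α P x ≤ ((PR D loss x + γ : ℝ) : EReal) :=
  iSup₂_le fun c hc => by
    have h1 := hLip c x x
    have h2 := (abs_le.1 (hest c hc x)).2
    rw [dist_comm] at h1
    rw [EReal.coe_le_coe_iff, PR]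
    linarith

theorem le_upperMin_of_close (hPO : ∀ θ, PR D loss θPO ≤ PR D loss θ)
    (hLip : ∀ θ₁ θ₂ θ, DPR D loss θ₁ θ - DPR D loss θ₂ θ ≤ α * dist θ₁ θ₂)
    (hest : ∀ c ∈ P, ∀ θ, |est c θ - DPR D loss c θ| ≤ γ) :
    ((PR D loss θPO - γ : ℝ) : EReal) ≤ upperMin est α P :=
  le_iInf fun x => le_iInf₂ fun c hc => by
    have h1 := hLip x c x
    have h2 := (abs_le.1 (hest c hc x)).1
    have h3 := hPO x
    rw [dist_comm] at h1
    rw [EReal.coe_le_coe_iff]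
    unfold PR at h3 ⊢
    linarith

theorem le_lowerBound_of_close
    (hLip : ∀ θ₁ θ₂ θ, DPR D loss θ₁ θ - DPR D loss θ₂ θ ≤ α * dist θ₁ θ₂)
    (hest : ∀ c ∈ P, ∀ θ, |est c θ - DPR D loss c θ| ≤ γ) {x c : M} (hc : c ∈ P)
    (hx : α * dist x c ≤ γ) : ((PR D loss x - 3 * γ : ℝ) : EReal) ≤ lowerBound est α P x := by
  refine le_trans ?_ (le_iSup₂ (f := fun c (_ : c ∈ P) =>
    ((est c x - α * dist x c : ℝ) : EReal)) c hc)
  have h1 := hLip x c x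
  have h2 := (abs_le.1 (hest c hc x)).1
  rw [EReal.coe_le_coe_iff, PR]
  linarith

theorem upperMin_le_of_close
    (hLip : ∀ θ₁ θ₂ θ, DPR D loss θ₁ θ - DPR D loss θ₂ θ ≤ α * dist θ₁ θ₂)
    (hest : ∀ c ∈ P, ∀ θ, |est c θ - DPR D loss c θ| ≤ γ) {x c : M} (hc : c ∈ P)
    (hx : α * dist x c ≤ γ) : upperMin est α P ≤ ((PR D loss x + 3 * γ : ℝ) : EReal) := by
  refine (iInf_le_of_le x (iInf₂_le c hc)).trans ?_
  have h1 := hLip c x x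
  have h2 := (abs_le.1 (hest c hc x)).2
  rw [dist_comm] at hx
  rw [EReal.coe_le_coe_iff, PR]
  linarith

end Bounds

theorem State.update_est_close {σ : State M} (hσ : σ.Regular D loss I θPO) {θ : M}
    {z : Fin (I.steps σ.phase * I.m₀) → Z}
    (hz : empiricalDeviation (D θ) loss z ≤ ENNReal.ofReal (tol σ.phase)) :
    ∀ c ∈ (σ.update loss I θ z).deployed, ∀ θ',
      |(σ.update loss I θ z).est c θ' - DPR D loss c θ'| ≤ tol σ.phase := by
  intro c hc θ'
  by_cases hcθ : c = θ
  · subst hcθ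
    have h := (le_iSup (fun θ' => ENNReal.ofReal |((I.steps σ.phase * I.m₀ : ℕ) : ℝ)⁻¹ *
      ∑ j, loss (z j) θ' - ∫ x, loss x θ' ∂(D c)|) θ').trans hz
    rw [ENNReal.ofReal_le_ofReal_iff (tol_pos _).le] at h
    simpa [State.update, DPR] using h
  · have hc' : c ∈ σ.deployed := by simpa [State.update, hcθ] using hc
    simpa [State.update, hcθ] using hσ.est_close c hc' θ'

open Classical in
theorem State.update_cover {σ : State M} (hσ : σ.Regular D loss I θPO) (θ : M)
    (z : Fin (I.steps σ.phase * I.m₀) → Z) : ∀ x ∈ (σ.update loss I θ z).active, ∃ c,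
      (c ∈ (σ.update loss I θ z).net ∨ c ∈ (σ.update loss I θ z).deployed) ∧
        x ∈ ball (I.radius σ.phase) c := by
  intro x hx
  obtain ⟨c, hc, hxc⟩ := hσ.cover x (State.update_active_subset σ θ z hx)
  refine ⟨c, ?_, hxc⟩
  by_cases hcθ : c = θ
  · exact Or.inr (by simp [State.update, hcθ])
  rcases hc with hc | hc
  · exact Or.inl (Finset.mem_filter.2 ⟨Finset.mem_erase.2 ⟨hcθ, hc⟩, x, hxc, hx⟩)
  · exact Or.inr (Finset.mem_insert_of_mem hc)

theorem State.opt_mem_update (hPO : ∀ θ, PR D loss θPO ≤ PR D loss θ)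
    (hLip : ∀ θ₁ θ₂ θ, DPR D loss θ₁ θ - DPR D loss θ₂ θ ≤ I.Lz * I.ε * dist θ₁ θ₂)
    {σ : State M} (hσ : σ.Regular D loss I θPO) {θ : M} {z : Fin (I.steps σ.phase * I.m₀) → Z}
    (hz : empiricalDeviation (D θ) loss z ≤ ENNReal.ofReal (tol σ.phase)) :
    θPO ∈ (σ.update loss I θ z).active := by
  have hest := State.update_est_close hσ hz
  refine ⟨hσ.opt_mem, fun h => not_le.2 h.2 ?_⟩
  refine (lowerBound_le_of_close hLip hest θPO).trans (le_trans ?_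
    (add_le_add_left (le_upperMin_of_close hPO hLip hest) _))
  rw [← EReal.coe_add, EReal.coe_le_coe_iff]
  linarith

/-- At the end of a phase with tolerance `γ`, the active models have suboptimality at most `8 γ`. -/
theorem State.gap_le_of_update_net_eq_empty (hPO : ∀ θ, PR D loss θPO ≤ PR D loss θ)
    (hLip : ∀ θ₁ θ₂ θ, DPR D loss θ₁ θ - DPR D loss θ₂ θ ≤ I.Lz * I.ε * dist θ₁ θ₂)
    {σ : State M} (hσ : σ.Regular D loss I θPO) {θ : M} {z : Fin (I.steps σ.phase * I.m₀) → Z}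
    (hz : empiricalDeviation (D θ) loss z ≤ ENNReal.ofReal (tol σ.phase))
    (hnet : (σ.update loss I θ z).net = ∅) :
    ∀ x ∈ (σ.update loss I θ z).active, gap D loss x ≤ 8 * tol σ.phase := by
  intro x hx
  have hest := State.update_est_close hσ hz
  have hcov : ∀ y ∈ (σ.update loss I θ z).active, ∃ c ∈ (σ.update loss I θ z).deployed,
      I.Lz * I.ε * dist y c ≤ tol σ.phase := fun y hy => by
    obtain ⟨c, hc, hyc⟩ := State.update_cover hσ θ z y hy
    rw [hnet] at hc
    exact ⟨c, by simpa using hc, Input.mul_dist_le_of_mem_ball hyc⟩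
  obtain ⟨c, hc, hxc⟩ := hcov x hx
  obtain ⟨c', hc', hxc'⟩ := hcov θPO (State.opt_mem_update hPO hLip hσ hz)
  have h : lowerBound (σ.update loss I θ z).est (I.Lz * I.ε) (σ.update loss I θ z).deployed x ≤
      upperMin (σ.update loss I θ z).est (I.Lz * I.ε) (σ.update loss I θ z).deployed +
        ((2 * tol σ.phase : ℝ) : EReal) := not_lt.1 fun hlt => hx.2 ⟨hx.1, hlt⟩
  have h' := (le_lowerBound_of_close hLip hest hc hxc).trans (h.trans
    (add_le_add_left (upperMin_le_of_close hLip hest hc' hxc') _))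
  rw [← EReal.coe_add, EReal.coe_le_coe_iff] at h'
  rw [gap_eq hPO]
  linarith

theorem State.next_regular (hN : ∀ p A, IsMinimalCover (I.radius p) A (N p A))
    (hPO : ∀ θ, PR D loss θPO ≤ PR D loss θ)
    (hLip : ∀ θ₁ θ₂ θ, DPR D loss θ₁ θ - DPR D loss θ₂ θ ≤ I.Lz * I.ε * dist θ₁ θ₂)
    {σ : State M} (hσ : σ.Regular D loss I θPO) {θ : M} {z : Fin (I.steps σ.phase * I.m₀) → Z}
    (hz : empiricalDeviation (D θ) loss z ≤ ENNReal.ofReal (tol σ.phase)) :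
    (σ.next loss I N θ z).Regular D loss I θPO := by
  classical
  have hopt := State.opt_mem_update hPO hLip hσ hz
  by_cases hnet : (σ.update loss I θ z).net = ∅
  · rw [State.next, if_pos hnet]
    refine State.regular_start hN hopt fun x hx => ?_
    have h := State.gap_le_of_update_net_eq_empty hPO hLip hσ hz hnet x hx
    change gap D loss x ≤ 16 * tol (σ.phase + 1)
    rw [tol_succ] at h
    linarith
  · rw [State.next, if_neg hnet]
    exact {
      opt_mem := hopt
      gap_le := fun x hx => hσ.gap_le x (State.update_active_subset σ θ z hx)
      net_gap_le := fun c hc => hσ.net_gap_le c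
        (Finset.mem_of_mem_erase (State.update_net_subset σ θ z hc))
      cover := State.update_cover hσ θ z
      est_close := State.update_est_close hσ hz
      net_nonempty := Finset.nonempty_iff_ne_empty.2 hnet }

end Invariant

theorem upperExpectation_le_of_le {X : Type*} [MeasurableSpace X] (μ : Measure X)
    [IsProbabilityMeasure μ] {f : X → ℝ≥0∞} {a b : ℝ≥0∞} {s : Set X}
    (ha : ∀ x ∉ s, f x ≤ a) (hb : ∀ x, f x ≤ b) : upperExpectation μ f ≤ a + b * μ s := by
  classical
  refine iInf_le_of_le (fun x => a + (toMeasurable μ s).indicator (fun _ => b) x) (iInf_le_of_le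
    (measurable_const.add (measurable_const.indicator (measurableSet_toMeasurable μ s)))
    (iInf_le_of_le (fun x => ?_) ?_))
  · by_cases hx : x ∈ toMeasurable μ s
    · simp only [Set.indicator_of_mem hx]
      exact le_add_left (hb x)
    · exact le_add_right (ha x fun hs => hx (subset_toMeasurable μ s hs))
  · rw [lintegral_add_left measurable_const, lintegral_const, measure_univ, mul_one,
      lintegral_indicator (measurableSet_toMeasurable μ s), setLIntegral_const,
      measure_toMeasurable]

theorem inv_card_mul_sum_le {M : Type*} {S : Finset M} (hS : S.Nonempty) {f : M → ℝ≥0∞} {b : ℝ≥0∞}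
    (h : ∀ θ ∈ S, f θ ≤ b) : (S.card : ℝ≥0∞)⁻¹ * ∑ θ ∈ S, f θ ≤ b := by
  have hc : (S.card : ℝ≥0∞) ≠ 0 := by exact_mod_cast hS.card_pos.ne'
  calc (S.card : ℝ≥0∞)⁻¹ * ∑ θ ∈ S, f θ ≤ (S.card : ℝ≥0∞)⁻¹ * (S.card * b) := by
        gcongr
        simpa using Finset.sum_le_card_nsmul S f b h
    _ = b := by rw [← mul_assoc, ENNReal.inv_mul_cancel hc (ENNReal.natCast_ne_top _), one_mul]

section Regret

variable {M Z : Type*} [MeasurableSpace Z] {D : M → Measure Z} {loss : Z → M → ℝ} {I : Input}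

/-- Bound on the regret from a state with `t` remaining steps, if the phases `p < q` are charged by
the deployments, where `Φ p` bounds the total suboptimality of the net of phase `p`, and the
later phases by their accuracy. -/
def State.potential (D : M → Measure Z) (loss : Z → M → ℝ) (I : Input) (Φ : ℕ → ℝ) (q : ℕ) (b : ℝ)
    (σ : State M) (t : ℕ) : ℝ :=
  (if σ.phase < q then I.steps σ.phase * ∑ θ ∈ σ.net, gap D loss θ else 0) +
    ∑ p ∈ Finset.Ico (σ.phase + 1) q, I.steps p * Φ p + (16 * tol q + b) * t

variable {Φ : ℕ → ℝ} {q : ℕ} {b : ℝ}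

theorem State.potential_nonneg (hgap0 : ∀ θ, 0 ≤ gap D loss θ) (hΦ0 : ∀ p, 0 ≤ Φ p) (hb : 0 ≤ b)
    (σ : State M) (t : ℕ) : 0 ≤ σ.potential D loss I Φ q b t := by
  have h1 : 0 ≤ ∑ θ ∈ σ.net, gap D loss θ := Finset.sum_nonneg fun θ _ => hgap0 θ
  have h2 : 0 ≤ ∑ p ∈ Finset.Ico (σ.phase + 1) q, I.steps p * Φ p :=
    Finset.sum_nonneg fun p _ => mul_nonneg (Nat.cast_nonneg _) (hΦ0 p)
  have := tol_pos q
  rw [State.potential]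
  split_ifs <;> positivity

open Classical in
theorem State.add_potential_erase_le (hgap0 : ∀ θ, 0 ≤ gap D loss θ) (hb : 0 ≤ b) {σ : State M}
    (hsteps : 0 < I.steps σ.phase) {θ : M} (hθ : θ ∈ σ.net)
    (hθgap : gap D loss θ ≤ 16 * tol σ.phase) {t : ℕ} (ht : 0 < t) :
    (min (I.steps σ.phase) t : ℕ) * gap D loss θ +
        State.potential D loss I Φ q b { σ with net := σ.net.erase θ } (t - I.steps σ.phase) + b ≤
      σ.potential D loss I Φ q b t := by
  have hmin : ((t - I.steps σ.phase : ℕ) : ℝ) = t - (min (I.steps σ.phase) t : ℕ) := by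
    rw [eq_sub_iff_add_eq]
    exact_mod_cast (by omega : t - I.steps σ.phase + min (I.steps σ.phase) t = t)
  have hmin1 : (1 : ℝ) ≤ (min (I.steps σ.phase) t : ℕ) := by
    exact_mod_cast (by omega : 1 ≤ min (I.steps σ.phase) t)
  have hmins : ((min (I.steps σ.phase) t : ℕ) : ℝ) ≤ I.steps σ.phase := by
    exact_mod_cast min_le_left _ t
  have hbm := le_mul_of_one_le_right hb hmin1
  have htq := tol_pos q
  have herase := Finset.add_sum_erase σ.net (gap D loss) hθ
  simp only [State.potential, hmin]
  generalize ((min (I.steps σ.phase) t : ℕ) : ℝ) = m at *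
  generalize ∑ p ∈ Finset.Ico (σ.phase + 1) q, (I.steps p : ℝ) * Φ p = r
  split_ifs with hpq
  · have h1 : m * gap D loss θ ≤ I.steps σ.phase * gap D loss θ :=
      mul_le_mul_of_nonneg_right hmins (hgap0 θ)
    have h2 : 0 ≤ tol q * m := by positivity
    rw [← herase, mul_add]
    linarith
  · have h1 : gap D loss θ ≤ 16 * tol q :=
      hθgap.trans (by linarith [tol_antitone (not_lt.1 hpq)])
    have h2 := mul_le_mul_of_nonneg_left h1 (zero_le_one.trans hmin1)
    linarith

variable [PseudoMetricSpace M] {N : ℕ → Set M → Finset M} {θ₀ θPO : M}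

theorem expRegretFrom_le_time (hD : ∀ θ, IsProbabilityMeasure (D θ))
    (hgap : ∀ θ, gap D loss θ ≤ 1) : ∀ (k t : ℕ) (σ : State M),
      expRegretFrom D loss I N θ₀ k t σ ≤ ENNReal.ofReal t := by
  intro k
  induction k with
  | zero => intro t σ; simp [expRegretFrom]
  | succ k ih =>
    intro t σ
    rw [expRegretFrom]
    split_ifs with hnet
    · exact ENNReal.ofReal_le_ofReal (mul_le_of_le_one_right (Nat.cast_nonneg t) (hgap θ₀))
    refine inv_card_mul_sum_le (Finset.nonempty_iff_ne_empty.2 hnet) fun θ _ => ?_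
    have := hD θ
    have h := upperExpectation_le_of_le
      (Measure.pi fun _ : Fin (I.steps σ.phase * I.m₀) => D θ) (s := ∅)
      (f := fun z => expRegretFrom D loss I N θ₀ k (t - I.steps σ.phase) (σ.next loss I N θ z))
      (fun z _ => ih _ _) (fun z => ih _ _)
    rw [measure_empty, mul_zero, add_zero] at h
    refine (add_le_add (ENNReal.ofReal_le_ofReal (mul_le_of_le_one_right (Nat.cast_nonneg _)
      (hgap θ))) h).trans ?_
    rw [← ENNReal.ofReal_add (Nat.cast_nonneg _) (Nat.cast_nonneg _)]
    refine ENNReal.ofReal_le_ofReal ?_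
    rw [← Nat.cast_add]
    exact Nat.cast_le.2 (by omega)

theorem State.potential_start_le (hN : ∀ p A, IsMinimalCover (I.radius p) A (N p A))
    (hΦ : ∀ p A S, (∀ θ ∈ A, gap D loss θ ≤ 16 * tol p) → IsMinimalCover (I.radius p) A S →
      ∑ θ ∈ S, gap D loss θ ≤ Φ p) {p : ℕ} {A : Set M} (hA : ∀ θ ∈ A, gap D loss θ ≤ 16 * tol p)
    (t : ℕ) : (State.start N p A).potential D loss I Φ q b t ≤
      ∑ i ∈ Finset.Ico p q, I.steps i * Φ i + (16 * tol q + b) * t := by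
  have h := mul_le_mul_of_nonneg_left (hΦ p A _ hA (hN p A)) (Nat.cast_nonneg (α := ℝ) (I.steps p))
  change (if p < q then (I.steps p : ℝ) * ∑ θ ∈ N p A, gap D loss θ else 0) +
    ∑ i ∈ Finset.Ico (p + 1) q, I.steps i * Φ i + (16 * tol q + b) * t ≤ _
  split_ifs with hpq
  · rw [Finset.sum_eq_sum_Ico_succ_bot hpq]
    linarith
  · rw [Finset.Ico_eq_empty (by omega), Finset.Ico_eq_empty (by omega)]
    simp

open Classical in
theorem State.potential_next_le (hgap0 : ∀ θ, 0 ≤ gap D loss θ)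
    (hN : ∀ p A, IsMinimalCover (I.radius p) A (N p A))
    (hPO : ∀ θ, PR D loss θPO ≤ PR D loss θ)
    (hLip : ∀ θ₁ θ₂ θ, DPR D loss θ₁ θ - DPR D loss θ₂ θ ≤ I.Lz * I.ε * dist θ₁ θ₂)
    (hΦ : ∀ p A S, (∀ θ ∈ A, gap D loss θ ≤ 16 * tol p) → IsMinimalCover (I.radius p) A S →
      ∑ θ ∈ S, gap D loss θ ≤ Φ p)
    {σ : State M} (hσ : σ.Regular D loss I θPO) {θ : M} {z : Fin (I.steps σ.phase * I.m₀) → Z}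
    (hz : empiricalDeviation (D θ) loss z ≤ ENNReal.ofReal (tol σ.phase)) (t : ℕ) :
    (σ.next loss I N θ z).potential D loss I Φ q b t ≤
      State.potential D loss I Φ q b { σ with net := σ.net.erase θ } t := by
  change _ ≤ (if σ.phase < q then (I.steps σ.phase : ℝ) * ∑ θ ∈ σ.net.erase θ, gap D loss θ else 0) +
    ∑ p ∈ Finset.Ico (σ.phase + 1) q, I.steps p * Φ p + (16 * tol q + b) * t
  by_cases hnet : (σ.update loss I θ z).net = ∅
  · rw [State.next, if_pos hnet]
    refine (State.potential_start_le hN hΦ (fun x hx => ?_) _).trans ?_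
    · have h := State.gap_le_of_update_net_eq_empty hPO hLip hσ hz hnet x hx
      change gap D loss x ≤ 16 * tol (σ.phase + 1)
      rw [tol_succ] at h
      linarith
    · have : 0 ≤ (if σ.phase < q then
          (I.steps σ.phase : ℝ) * ∑ θ ∈ σ.net.erase θ, gap D loss θ else 0) := by
        split_ifs
        · exact mul_nonneg (Nat.cast_nonneg _) (Finset.sum_nonneg fun θ _ => hgap0 θ)
        · exact le_rfl
      change ∑ i ∈ Finset.Ico (σ.phase + 1) q, I.steps i * Φ i + _ ≤ _
      linarith
  · rw [State.next, if_neg hnet]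
    have hsub : ∑ θ ∈ (σ.update loss I θ z).net, gap D loss θ ≤
        ∑ θ ∈ σ.net.erase θ, gap D loss θ :=
      Finset.sum_le_sum_of_subset_of_nonneg (State.update_net_subset σ θ z) fun θ _ _ => hgap0 θ
    change (if σ.phase < q then
        (I.steps σ.phase : ℝ) * ∑ θ ∈ (σ.update loss I θ z).net, gap D loss θ else 0) +
      ∑ p ∈ Finset.Ico (σ.phase + 1) q, I.steps p * Φ p + (16 * tol q + b) * t ≤ _
    split_ifs
    · gcongr
    · exact le_rfl

/-- The expected regret from a regular state, if the estimates of a deployment are inaccurate with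
a probability of at most `b / T`. -/
theorem expRegretFrom_le_potential (hD : ∀ θ, IsProbabilityMeasure (D θ))
    (hgap1 : ∀ θ, gap D loss θ ≤ 1)
    (hN : ∀ p A, IsMinimalCover (I.radius p) A (N p A))
    (hPO : ∀ θ, PR D loss θPO ≤ PR D loss θ)
    (hLip : ∀ θ₁ θ₂ θ, DPR D loss θ₁ θ - DPR D loss θ₂ θ ≤ I.Lz * I.ε * dist θ₁ θ₂)
    (hΦ : ∀ p A S, (∀ θ ∈ A, gap D loss θ ≤ 16 * tol p) → IsMinimalCover (I.radius p) A S →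
      ∑ θ ∈ S, gap D loss θ ≤ Φ p)
    (hsteps : ∀ p, 0 < I.steps p) (hb : 0 ≤ b) {T : ℕ}
    (hfail : ∀ p θ, ENNReal.ofReal T * (Measure.pi fun _ : Fin (I.steps p * I.m₀) => D θ)
      {z | ENNReal.ofReal (tol p) < empiricalDeviation (D θ) loss z} ≤ ENNReal.ofReal b) :
    ∀ (k t : ℕ), t ≤ T → ∀ σ : State M, σ.Regular D loss I θPO →
      expRegretFrom D loss I N θ₀ k t σ ≤ ENNReal.ofReal (σ.potential D loss I Φ q b t) := by
  classical
  have hgap0 : ∀ θ, 0 ≤ gap D loss θ := fun θ => by rw [gap_eq hPO]; linarith [hPO θ]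
  have hΦ0 : ∀ p, 0 ≤ Φ p := fun p => by
    simpa using hΦ p ∅ ∅ (by simp) ⟨⟨by simp, by simp⟩, by simp⟩
  intro k
  induction k with
  | zero => intro t _ σ _; simp [expRegretFrom]
  | succ k ih =>
    intro t htT σ hσ
    rcases Nat.eq_zero_or_pos t with rfl | ht
    · exact (expRegretFrom_le_time hD hgap1 _ _ _).trans (by simp)
    rw [expRegretFrom, if_neg hσ.net_nonempty.ne_empty]
    refine inv_card_mul_sum_le hσ.net_nonempty fun θ hθ => ?_
    have := hD θ
    set V := State.potential D loss I Φ q b { σ with net := σ.net.erase θ } (t - I.steps σ.phase)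
    have hV : 0 ≤ V := State.potential_nonneg hgap0 hΦ0 hb _ _
    have h := upperExpectation_le_of_le
      (Measure.pi fun _ : Fin (I.steps σ.phase * I.m₀) => D θ)
      (f := fun z => expRegretFrom D loss I N θ₀ k (t - I.steps σ.phase) (σ.next loss I N θ z))
      (a := ENNReal.ofReal V) (b := ENNReal.ofReal T)
      (s := {z | ENNReal.ofReal (tol σ.phase) < empiricalDeviation (D θ) loss z})
      (fun z hz => by
        have hz' := not_lt.1 fun h => hz (by simpa using h)
        exact (ih _ (by omega) _ (State.next_regular hN hPO hLip hσ hz')).trans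
          (ENNReal.ofReal_le_ofReal (State.potential_next_le hgap0 hN hPO hLip hΦ hσ hz' _)))
      (fun z => (expRegretFrom_le_time hD hgap1 _ _ _).trans
        (ENNReal.ofReal_le_ofReal (Nat.cast_le.2 (by omega))))
    refine (add_le_add_right (h.trans (add_le_add_right (hfail _ _) _)) _).trans ?_
    rw [← ENNReal.ofReal_add hV hb, ← ENNReal.ofReal_add
      (mul_nonneg (Nat.cast_nonneg _) (hgap0 θ)) (by positivity), ← add_assoc]
    exact ENNReal.ofReal_le_ofReal (State.add_potential_erase_le hgap0 hb (hsteps _) hθ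
      (hσ.net_gap_le θ hθ) ht)

end Regret

section Steps

variable {I : Input}

theorem Input.le_steps_mul (hm : 1 ≤ I.m₀) (p : ℕ) :
    (2 * I.C + 3 * Real.sqrt (Real.log I.T)) ^ 2 ≤ (I.steps p * I.m₀ : ℕ) * tol p ^ 2 := by
  have hm' : (0 : ℝ) < I.m₀ := by exact_mod_cast hm
  have ht := tol_pos p
  have h := Nat.le_ceil ((2 * I.C + 3 * Real.sqrt (Real.log I.T)) ^ 2 / (tol p ^ 2 * I.m₀))
  rw [div_le_iff₀ (by positivity)] at h
  push_cast
  rw [Input.steps]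
  linarith

theorem Input.steps_pos (hC : 0 ≤ I.C) (hm : 1 ≤ I.m₀)
    (hB : (I.m₀ : ℝ) ≤ (Real.sqrt (Real.log I.T) + I.C) ^ 2) (p : ℕ) : 0 < I.steps p := by
  have hm' : (0 : ℝ) < I.m₀ := by exact_mod_cast hm
  have hL := Real.sqrt_nonneg (Real.log I.T)
  have ht := tol_pos p
  have hpos : 0 < Real.sqrt (Real.log I.T) + I.C :=
    lt_of_le_of_ne (by positivity) fun h => by rw [← h] at hB; norm_num at hB; linarith
  have : 0 < 2 * I.C + 3 * Real.sqrt (Real.log I.T) := by linarith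
  exact Nat.ceil_pos.2 (by positivity)

theorem Input.steps_le (hC : 0 ≤ I.C) (hm : 1 ≤ I.m₀)
    (hB : (I.m₀ : ℝ) ≤ (Real.sqrt (Real.log I.T) + I.C) ^ 2) (p : ℕ) :
    (I.steps p : ℝ) ≤ 10 * ((Real.sqrt (Real.log I.T) + I.C) ^ 2 / I.m₀) / tol p ^ 2 := by
  have hm' : (0 : ℝ) < I.m₀ := by exact_mod_cast hm
  have hL := Real.sqrt_nonneg (Real.log I.T)
  have ht := tol_pos p
  have ht1 : tol p ^ 2 ≤ 1 := pow_le_one₀ ht.le (tol_antitone (Nat.zero_le p) |>.trans_eq (by simp [tol]))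
  refine (Nat.ceil_lt_add_one (by positivity)).le.trans ?_
  rw [mul_comm (tol p ^ 2), ← div_div, ← sub_nonneg, ← sub_sub, ← sub_div, sub_nonneg,
    le_div_iff₀ (by positivity), one_mul, ← mul_div_assoc, ← sub_div]
  refine ht1.trans ((le_div_iff₀ hm').2 ?_)
  nlinarith [mul_nonneg hL hC]

end Steps

theorem sum_pow_le_pow {y : ℝ} (hy : 2 ≤ y) (q : ℕ) : ∑ i ∈ Finset.range q, y ^ i ≤ y ^ q := by
  induction q with
  | zero => simp
  | succ q ih =>
    have : 0 < y ^ q := by positivity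
    rw [Finset.sum_range_succ, pow_succ]
    nlinarith

/-- The choice of the phase that balances the two parts of the regret bound. -/
theorem exists_phase_bound {T W a d : ℝ} (hT : 0 < T) (hW : 0 < W) (ha : 0 ≤ a) (hd : 0 ≤ d) {R : ℝ}
    (hR : R = T ^ ((d + 1) / (d + 2)) * (a * W) ^ (1 / (d + 2)) + Real.sqrt T * Real.sqrt W) :
    T ≤ R ∨ ∃ q : ℕ, W * (2 ^ q + a * ((2 : ℝ) ^ q) ^ (d + 1)) ≤ R ∧ T / 2 ^ q ≤ 2 * R := by
  set R₁ := Real.sqrt T * Real.sqrt W with hR1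
  set R₂ := T ^ ((d + 1) / (d + 2)) * (a * W) ^ (1 / (d + 2)) with hR2
  have hR1pos : 0 < R₁ := mul_pos (Real.sqrt_pos.2 hT) (Real.sqrt_pos.2 hW)
  have hR2nn : 0 ≤ R₂ := by positivity
  have hRpos : 0 < R := by linarith
  have hd1 : 0 ≤ d + 1 := by linarith
  rcases le_or_gt T R with h | h
  · exact Or.inl h
  obtain ⟨q, hq1, hq2⟩ := exists_nat_pow_near (x := T / R) ((one_le_div hRpos).2 h.le)
    (one_lt_two : (1 : ℝ) < 2)
  refine Or.inr ⟨q, ?_, ?_⟩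
  · have h1 : W * 2 ^ q ≤ R₁ := by
      have hsq : R₁ * R₁ = W * T := by
        rw [hR1, mul_mul_mul_comm, Real.mul_self_sqrt hT.le, Real.mul_self_sqrt hW.le, mul_comm]
      calc W * 2 ^ q ≤ W * (T / R₁) := by
            gcongr
            exact hq1.trans (div_le_div_of_nonneg_left hT.le hR1pos (by linarith))
        _ = R₁ := by rw [← mul_div_assoc, ← hsq, mul_div_cancel_right₀ _ hR1pos.ne']
    have h2 : W * (a * ((2 : ℝ) ^ q) ^ (d + 1)) ≤ R₂ := by
      rcases ha.eq_or_lt with rfl | ha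
      · simpa using hR2nn
      have hR2pos : 0 < R₂ := by positivity
      have hpow : R₂ ^ (d + 1) * R₂ = T ^ (d + 1) * (a * W) := by
        rw [← Real.rpow_add_one hR2pos.ne', hR2, Real.mul_rpow (by positivity) (by positivity),
          ← Real.rpow_mul hT.le, ← Real.rpow_mul (by positivity)]
        have e1 : (d + 1) / (d + 2) * (d + 1 + 1) = d + 1 := by field_simp; ring
        have e2 : 1 / (d + 2) * (d + 1 + 1) = 1 := by field_simp; ring
        rw [e1, e2, Real.rpow_one]
      have hpos : 0 < R₂ ^ (d + 1) := by positivity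
      calc W * (a * ((2 : ℝ) ^ q) ^ (d + 1)) ≤ W * (a * (T / R₂) ^ (d + 1)) := by
            gcongr
            exact hq1.trans (div_le_div_of_nonneg_left hT.le hR2pos (by linarith))
        _ = T ^ (d + 1) * (a * W) / R₂ ^ (d + 1) := by
            rw [Real.div_rpow hT.le hR2pos.le]; ring
        _ = R₂ := by rw [← hpow, mul_div_cancel_left₀ _ hpos.ne']
    rw [mul_add]
    linarith
  · rw [div_lt_iff₀ hRpos, pow_succ] at hq2
    rw [div_le_iff₀ (by positivity)]
    linarith

theorem sum_steps_mul_le {I : Input} (hC : 0 ≤ I.C) (hm : 1 ≤ I.m₀)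
    (hB : (I.m₀ : ℝ) ≤ (Real.sqrt (Real.log I.T) + I.C) ^ 2) {G α d : ℝ} (hG : 0 ≤ G) (hα : 0 ≤ α)
    (hd : 0 ≤ d) (q : ℕ) :
    ∑ i ∈ Finset.range q, I.steps i * (G * (tol i * (1 + (α / tol i) ^ d))) ≤
      10 * G * (((Real.sqrt (Real.log I.T) + I.C) ^ 2 / I.m₀) *
        (2 ^ q + α ^ d * ((2 : ℝ) ^ q) ^ (d + 1))) := by
  set W := (Real.sqrt (Real.log I.T) + I.C) ^ 2 / I.m₀
  have hW : 0 ≤ W := by positivity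
  have hαd : 0 ≤ α ^ d := by positivity
  have hy : (2 : ℝ) ≤ 2 ^ (d + 1) := by
    simpa using Real.rpow_le_rpow_of_exponent_le one_le_two (by linarith : (1 : ℝ) ≤ d + 1)
  have hpow : ∀ i : ℕ, ((2 : ℝ) ^ i) ^ (d + 1) = ((2 : ℝ) ^ (d + 1)) ^ i := fun i => by
    rw [← Real.rpow_natCast, ← Real.rpow_mul zero_le_two, mul_comm, Real.rpow_mul zero_le_two,
      Real.rpow_natCast]
  have hterm : ∀ i ∈ Finset.range q, I.steps i * (G * (tol i * (1 + (α / tol i) ^ d))) ≤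
      10 * G * W * 2 ^ i + 10 * G * W * α ^ d * ((2 : ℝ) ^ (d + 1)) ^ i := by
    intro i _
    have ht := tol_pos i
    have htol : tol i = ((2 : ℝ) ^ i)⁻¹ := by rw [tol, one_div, inv_pow]
    calc I.steps i * (G * (tol i * (1 + (α / tol i) ^ d)))
        ≤ 10 * W / tol i ^ 2 * (G * (tol i * (1 + (α / tol i) ^ d))) := by
          gcongr
          exact I.steps_le hC hm hB i
      _ = _ := by
          rw [← hpow, Real.rpow_add_one (by positivity), htol, div_inv_eq_mul,
            Real.mul_rpow hα (by positivity)]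
          field_simp
  refine (Finset.sum_le_sum hterm).trans ?_
  rw [Finset.sum_add_distrib, ← Finset.mul_sum, ← Finset.mul_sum, hpow]
  have h1 := mul_le_mul_of_nonneg_left (sum_pow_le_pow le_rfl q) (by positivity : 0 ≤ 10 * G * W)
  have h2 := mul_le_mul_of_nonneg_left (sum_pow_le_pow hy q)
    (by positivity : 0 ≤ 10 * G * W * α ^ d)
  linarith

end PerfPred

end

theorem mainTheorem1 (n : ℕ) (d c : ℝ) (hd : 0 ≤ d) :
    ∃ K : ℝ, 0 < K ∧
      ∀ (Z : Type*) [MetricSpace Z] [SecondCountableTopology Z] [MeasurableSpace Z] [BorelSpace Z]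
        (Θ : Set (EuclideanSpace ℝ (Fin n))) (_ : ∀ θ ∈ Θ, ‖θ‖ ≤ 1)
        (D : Θ → Measure Z) (_ : ∀ θ, IsProbabilityMeasure (D θ))
        (loss : Z → Θ → ℝ) (_ : ∀ z θ, loss z θ ∈ Set.Icc (0 : ℝ) 1)
        (I : PerfPred.Input)
        (_ : ∀ θ, LipschitzWith I.Lz fun z => loss z θ)
        (_ : PerfPred.IsSensitive D I.ε)
        (_ : ∃ θPO : Θ, ∀ θ, PerfPred.PR D loss θPO ≤ PerfPred.PR D loss θ)
        (_ : 0 ≤ I.C) (_ : PerfPred.rademacherComplexity D loss ≤ ENNReal.ofReal I.C)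
        (_ : 1 ≤ I.m₀) (_ : (I.m₀ : ℝ) ≤ (Real.sqrt (Real.log I.T) + I.C) ^ 2)
        (_ : PerfPred.HasSeqZoomingDim D loss (I.Lz * I.ε) d c)
        (N : ℕ → Set Θ → Finset Θ)
        (_ : ∀ p A, PerfPred.IsMinimalCover (I.radius p) A (N p A))
        (θ₀ : Θ),
        PerfPred.regret D loss I N θ₀ ≤ ENNReal.ofReal (K *
          ((I.T : ℝ) ^ ((d + 1) / (d + 2)) *
              ((I.Lz * I.ε : ℝ) ^ d * (Real.sqrt (Real.log I.T) + I.C) ^ 2 / I.m₀) ^ (1 / (d + 2)) +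
            Real.sqrt I.T * ((Real.sqrt (Real.log I.T) + I.C) / Real.sqrt I.m₀))) := by
  open PerfPred in
  obtain ⟨m, hm⟩ := exists_packing_bound n
  set G : ℝ := m * (16 + 64 * |c| * 3 ^ d) with hGdef
  have hG : 0 ≤ G := by positivity
  refine ⟨10 * G + 33, by positivity, ?_⟩
  intro Z _ _ _ _ Θ hΘ D hD loss h01 I hLz hsens ⟨θPO, hPO⟩ hC hR hm₀ hB hzoom N hN θ₀
  have hc : ∀ θ, Continuous fun z => loss z θ := fun θ => (hLz θ).continuous
  have hLip := DPR_sub_le hD h01 hLz hsens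
  have hDPR := DPR_mem_Icc hD h01 hc
  have hgap1 : ∀ θ, gap D loss θ ≤ 1 := fun θ => by
    rw [gap_eq hPO]
    linarith [(hDPR θ θ).2, (hDPR θPO θPO).1, show PR D loss θ = DPR D loss θ θ from rfl,
      show PR D loss θPO = DPR D loss θPO θPO from rfl]
  refine iSup_le fun k => ?_
  rcases Nat.eq_zero_or_pos I.T with hT | hT
  · exact (expRegretFrom_le_time hD hgap1 _ _ _).trans (by simp [hT])
  have hT1 : (1 : ℝ) ≤ I.T := by exact_mod_cast hT
  have hT0 : (0 : ℝ) < I.T := by linarith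
  have hm0 : (0 : ℝ) < I.m₀ := by exact_mod_cast hm₀
  have hL := Real.sqrt_nonneg (Real.log I.T)
  set B := Real.sqrt (Real.log I.T) + I.C with hBdef
  have hB0 : 0 ≤ B := by positivity
  set W := B ^ 2 / I.m₀ with hWdef
  have hW : 1 ≤ W := (one_le_div hm0).2 hB
  have hsqrtW : B / Real.sqrt I.m₀ = Real.sqrt W := by
    rw [hWdef, Real.sqrt_div (sq_nonneg B), Real.sqrt_sq hB0]
  rw [mul_div_assoc, ← hWdef, hsqrtW]
  set α : ℝ := I.Lz * I.ε with hα
  have hα0 : 0 ≤ α := by positivity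
  set R := (I.T : ℝ) ^ ((d + 1) / (d + 2)) * (α ^ d * W) ^ (1 / (d + 2)) +
    Real.sqrt I.T * Real.sqrt W with hRdef
  have hR1 : 1 ≤ R := by
    have h1 : 1 ≤ Real.sqrt I.T * Real.sqrt W :=
      one_le_mul_of_one_le_of_one_le (Real.one_le_sqrt.2 hT1) (Real.one_le_sqrt.2 hW)
    have h2 : 0 ≤ (I.T : ℝ) ^ ((d + 1) / (d + 2)) * (α ^ d * W) ^ (1 / (d + 2)) := by positivity
    linarith
  have hGR : 0 ≤ G * R := by positivity
  rcases exists_phase_bound hT0 (by linarith) (by positivity : 0 ≤ α ^ d) hd hRdef with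
    hTR | ⟨q, hq1, hq2⟩
  · refine (expRegretFrom_le_time hD hgap1 _ _ _).trans (ENNReal.ofReal_le_ofReal ?_)
    linarith
  have hdiam : ∀ x y : Θ, edist x y ≤ 2 := fun x y => by
    rw [edist_dist]
    refine (ENNReal.ofReal_le_ofReal ?_).trans_eq (ENNReal.ofReal_ofNat 2)
    rw [Subtype.dist_eq, dist_eq_norm]
    exact (norm_sub_le _ _).trans (by linarith [hΘ x x.2, hΘ y y.2])
  have hcoe : ((I.Lz * I.ε : ℝ≥0) : ℝ) = α := NNReal.coe_mul _ _
  have hΦ : ∀ p A S, (∀ θ ∈ A, gap D loss θ ≤ 16 * tol p) → IsMinimalCover (I.radius p) A S →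
      ∑ θ ∈ S, gap D loss θ ≤ G * (tol p * (1 + (α / tol p) ^ d)) := fun p A S hA hS => by
    rw [← hcoe]
    exact sum_gap_le (hm Θ) hPO hdiam hd (by rw [hcoe]; exact hLip) (by rw [hcoe]; exact hzoom)
      (tol_pos p) hA hS
  have hsteps := I.steps_pos hC hm₀ hB
  have hexp : (I.T : ℝ) * Real.exp (-(18 * Real.sqrt (Real.log I.T) ^ 2)) ≤ 1 / I.T := by
    have hlog := Real.log_nonneg hT1
    rw [Real.sq_sqrt hlog, le_div_iff₀ hT0]
    nth_rewrite 1 3 [← Real.exp_log hT0]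
    rw [← Real.exp_add, ← Real.exp_add, Real.exp_le_one_iff]
    linarith
  have hfail : ∀ p θ, ENNReal.ofReal I.T * (Measure.pi fun _ : Fin (I.steps p * I.m₀) => D θ)
      {z | ENNReal.ofReal (tol p) < empiricalDeviation (D θ) loss z} ≤
        ENNReal.ofReal (1 / I.T) := fun p θ => by
    refine (mul_le_mul_right (measure_empiricalDeviation_gt_le h01 hc hD hC hL (tol_pos p) hR
      (Nat.mul_pos (hsteps p) hm₀) (I.le_steps_mul hm₀ p) θ) _).trans ?_
    rw [← ENNReal.ofReal_mul hT0.le]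
    exact ENNReal.ofReal_le_ofReal hexp
  have hgap0 : ∀ x ∈ (Set.univ : Set Θ), gap D loss x ≤ 16 * tol 0 := fun x _ => by
    have := hgap1 x
    simp only [tol, pow_zero]
    linarith
  refine (expRegretFrom_le_potential (q := q) hD hgap1 hN hPO hLip hΦ hsteps (by positivity) hfail
    k I.T le_rfl _ (State.regular_start hN (Set.mem_univ θPO) hgap0)).trans
    (ENNReal.ofReal_le_ofReal ((State.potential_start_le hN hΦ hgap0 _).trans ?_))
  rw [← Finset.range_eq_Ico]
  have hsum := sum_steps_mul_le hC hm₀ hB hG hα0 hd q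
  have hmul := mul_le_mul_of_nonneg_left hq1 (by positivity : 0 ≤ 10 * G)
  have htolT : tol q * I.T = I.T / 2 ^ q := by rw [tol, one_div, inv_pow]; field_simp
  have hTT : 1 / (I.T : ℝ) * I.T = 1 := one_div_mul_cancel hT0.ne'
  linarith
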